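/- Let $M$ be a smooth real surface or a complex (holomorphic) surface, i.e. a two-dimensional manifold over $\mathbb K=\mathbb R$ or $\mathbb C$, and let $\mathcal W$ be a $3$-web on $M$: three foliations by curves whose tangent lines $T^h,T^v,T^t$ are pairwise transversal. Let $h$ be the projection onto $T^h$ along $T^v$, $v=\mathrm{id}-h$, and let $j$ be the involution that exchanges $T^h$ and $T^v$ and equals $-\mathrm{id}$ on $T^t$. Let $\nabla$ be the Chern connection of $\mathcal W$, i.e. the linear connection with $\nabla h=0$, $\nabla j=0$ and $T(hX,vY)=0$ for its torsion $T$, and let $R$ be its curvature, $R(X,Y)Z=\nabla_X\nabla_YZ-\nabla_Y\nabla_XZ-\nabla_{[X,Y]}Z$. Let $p\in M$ and let $(e_1,\,e_2=je_1)$, with $e_1$ a nonvanishing section of $T^h$, be a smooth adapted frame near $p$. A tensor field $C$ in $(T^{h*})^{\otimes m}\otimes T^h$ is identified with its component $C(e_1,\dots,e_1)=C\,e_1$. Write $C_i$ ($i=1,2$) for the tensor field in $(T^{h*})^{\otimes (m+1)}\otimes T^h$ with $C_i(e_1,e_1,\dots,e_1)=(\nabla_{e_i}C)(e_1,\dots,e_1)$,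 and $C_{i_1i_2\cdots i_k}=(C_{i_2\cdots i_k})_{i_1}$. Let $\mathcal R$ be the tensor in $(T^{h*})^{\otimes 3}\otimes T^h$ with $\mathcal R(hX,hY)hZ=R(jhX,hY)hZ$, and suppose that $\mathcal R\ne0$ at $p$. For a section $s$ of $T^{h*}\otimes T^{h*}\otimes T^h$ consider the second order operator $P_\varphi=(P_2,\varphi)$, where the two components of $P_2$ are $$s_{22}-\bigl(2s_{21}-ss_2+2ss_1+\mathcal R s+\mathcal R_2\bigr),\qquad s_{11}-\bigl(2s_{21}-2ss_2+ss_1+\mathcal R s+\mathcal R_1\bigr),$$ and $$\begin{aligned}\varphi(s)=&-24\mathcal R s_{21}-(24\mathcal R s+12\mathcal R_1-6\mathcal R_2)s_1+(24\mathcal R s+6\mathcal R_1-12\mathcal R_2)s_2+3\mathcal R s^3\\&+(-3\mathcal R_{22}+\mathcal R_{21}+2\mathcal R_{12}-13\mathcal R^2-3\mathcal R_{11})s\\&+2\mathcal R_{122}+\mathcal R_{221}-\mathcal R_{112}-5\mathcal R\mathcal R_1-2\mathcal R_{121}-11\mathcal R\mathcal R_2.\end{aligned}$$ For $k\ge 2$,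 a formal solution of order $k$ of $P_\varphi$ at $p$ is a $k$-jet $j_{k,p}s$ of a smooth section $s$ such that the $(k-2)$-jet of $P_\varphi(s)$ at $p$ vanishes. **Lemma.** Let $j_{2,p}s$ be a formal solution of order $2$ of $P_\varphi$ at $p$. It can be lifted to a formal solution of order $3$ (that is, there is a formal solution $j_{3,p}s'$ of order $3$ with $j_{2,p}s'=j_{2,p}s$) if and only if, at $p$, $$\begin{aligned}\psi^1s&:=24\mathcal R s_2^2-48\mathcal R s_1s_2+\alpha(s)s_1+\beta(s)s_2+\gamma(s)=0,\\ \psi^2s&:=-24\mathcal R s_1^2+48\mathcal R s_1s_2+\hat\alpha(s)s_1+\hat\beta(s)s_2+\hat\gamma(s)=0,\end{aligned}$$ where $\alpha,\beta,\hat\alpha,\hat\beta$ are polynomials in $s$ of degree at most $2$ and $\gamma,\hat\gamma$ are polynomials in $s$ of degree at most $3$, given by $$\begin{aligned} \alpha(s)=\;&30\mathcal R s^2-18\mathcal R_2s-\tfrac{3}{4\mathcal R}\bigl(-16\mathcal R\mathcal R_{22}+14\mathcal R_2^2-40\mathcal R^3-56\mathcal R_1\mathcal R_2+40\mathcal R\mathcal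 R_{12}+56\mathcal R_1^2-40\mathcal R\mathcal R_{11}\bigr),\\ \beta(s)=\;&\tfrac{3}{4\mathcal R}(24\mathcal R\mathcal R_2-24\mathcal R\mathcal R_1)s-15\mathcal R s^2\\&-\tfrac{3}{4\mathcal R}\bigl(70\mathcal R_1\mathcal R_2-44\mathcal R\mathcal R_{12}+20\mathcal R\mathcal R_{11}+20\mathcal R\mathcal R_{22}-28\mathcal R_1^2-28\mathcal R_2^2-60\mathcal R^3\bigr),\\ \gamma(s)=\;&-\tfrac{3}{4\mathcal R}(-6\mathcal R\mathcal R_1+3\mathcal R\mathcal R_2)s^3\\ &-\tfrac{3}{4\mathcal R}\bigl(7\mathcal R_2\mathcal R_{12}+12\mathcal R\mathcal R_{112}-14\mathcal R_1\mathcal R_{12}-7\mathcal R_2\mathcal R_{22}+14\mathcal R_1\mathcal R_{11}-8\mathcal R\mathcal R_{111}+4\mathcal R\mathcal R_{222}\\ &\qquad-47\mathcal R_2\mathcal R^2+14\mathcal R_1\mathcal R_{22}-7\mathcal R_{11}\mathcal R_2-30\mathcal R_1\mathcal R^2-12\mathcal R\mathcal R_{122}\bigr)s\\ &-\tfrac{3}{4\mathcal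 R}\bigl(-7\mathcal R_2\mathcal R_{112}+7\mathcal R_2\mathcal R_{122}+35\mathcal R_1\mathcal R_2\mathcal R-38\mathcal R_1^2\mathcal R-2\mathcal R_2^2\mathcal R+12\mathcal R_{1122}\mathcal R-8\mathcal R_{1112}\mathcal R\\ &\qquad-4\mathcal R_{1222}\mathcal R-48\mathcal R^2\mathcal R_{12}+8\mathcal R^2\mathcal R_{11}+40\mathcal R^2\mathcal R_{22}+8\mathcal R^4-14\mathcal R_1\mathcal R_{122}+14\mathcal R_1\mathcal R_{112}\bigr),\\ \hat\alpha(s)=\;&\tfrac{3}{4\mathcal R}(24\mathcal R\mathcal R_2-24\mathcal R\mathcal R_1)s-15\mathcal R s^2\\&-\tfrac{3}{4\mathcal R}\bigl(20\mathcal R\mathcal R_{22}+70\mathcal R_1\mathcal R_2-28\mathcal R_1^2+60\mathcal R^3-28\mathcal R_2^2-44\mathcal R\mathcal R_{21}+20\mathcal R\mathcal R_{11}\bigr),\\ \hat\beta(s)=\;&30\mathcal R s^2+18\mathcal R_1s-\tfrac{3}{4\mathcal R}\bigl(40\mathcal R^3-16\mathcal R\mathcal R_{11}-56\mathcal R_1\mathcal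 R_2+56\mathcal R_2^2+14\mathcal R_1^2+40\mathcal R\mathcal R_{21}-40\mathcal R\mathcal R_{22}\bigr),\\ \hat\gamma(s)=\;&-\tfrac{3}{4\mathcal R}(3\mathcal R\mathcal R_1-6\mathcal R\mathcal R_2)s^3\\ &-\tfrac{3}{4\mathcal R}\bigl(-7\mathcal R_1\mathcal R_{22}-14\mathcal R_2\mathcal R_{21}+12\mathcal R\mathcal R_{221}+14\mathcal R_{11}\mathcal R_2+7\mathcal R_1\mathcal R_{21}-12\mathcal R\mathcal R_{211}-8\mathcal R\mathcal R_{222}\\ &\qquad+14\mathcal R_2\mathcal R_{22}-7\mathcal R_1\mathcal R_{11}+4\mathcal R\mathcal R_{111}+30\mathcal R_2\mathcal R^2+47\mathcal R_1\mathcal R^2\bigr)s\\ &-\tfrac{3}{4\mathcal R}\bigl(35\mathcal R_1\mathcal R_2\mathcal R-7\mathcal R_1\mathcal R_{211}+7\mathcal R_1\mathcal R_{221}+8\mathcal R_{2221}\mathcal R+4\mathcal R_{2111}\mathcal R-12\mathcal R_{2211}\mathcal R+8\mathcal R^2\mathcal R_{22}\\ &\qquad-2\mathcal R_1^2\mathcal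 R+40\mathcal R^2\mathcal R_{11}-48\mathcal R^2\mathcal R_{21}-38\mathcal R_2^2\mathcal R-8\mathcal R^4+14\mathcal R_2\mathcal R_{211}-14\mathcal R_2\mathcal R_{221}\bigr). \end{aligned}$$ -/

import Mathlib

open Filter Topology
open scoped Manifold ContDiff

noncomputable section

/-! ### Three-webs on a surface and their Chern connection

`𝕜` is `ℝ` or `ℂ`; a surface is a `C^∞` (over `ℂ`: holomorphic) manifold `M` modelled on `𝕜²`. -/

/-- The model plane `𝕜²`. -/
abbrev Plane (𝕜 : Type*) [RCLike 𝕜] : Type _ := EuclideanSpace 𝕜 (Fin 2)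

section Webs

variable {𝕜 : Type*} [RCLike 𝕜] {M : Type*} [TopologicalSpace M] [ChartedSpace (Plane 𝕜) M]
  [IsManifold 𝓘(𝕜, Plane 𝕜) ∞ M]

/-- The vector field `X` is of class `C^∞` on a neighbourhood of `p`. -/
def SmoothFieldNear (X : (x : M) → TangentSpace 𝓘(𝕜, Plane 𝕜) x) (p : M) : Prop :=
  ∀ᶠ y in 𝓝 p, ContMDiffAt 𝓘(𝕜, Plane 𝕜) (𝓘(𝕜, Plane 𝕜).prod 𝓘(𝕜, Plane 𝕜)) ∞
    (fun x => (⟨x, X x⟩ : TangentBundle 𝓘(𝕜, Plane 𝕜) M)) y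

/-- The function `f` is of class `C^∞` on a neighbourhood of `p`. -/
def SmoothFunNear (f : M → 𝕜) (p : M) : Prop :=
  ∀ᶠ y in 𝓝 p, ContMDiffAt 𝓘(𝕜, Plane 𝕜) 𝓘(𝕜, 𝕜) ∞ f y

/-- Around every point the distribution `L` is spanned by one smooth vector field. -/
def IsSmoothLineField (L : (x : M) → Submodule 𝕜 (TangentSpace 𝓘(𝕜, Plane 𝕜) x)) : Prop :=
  ∀ p : M, ∃ X : (x : M) → TangentSpace 𝓘(𝕜, Plane 𝕜) x,
    SmoothFieldNear X p ∧ ∀ᶠ y in 𝓝 p, L y = Submodule.span 𝕜 {X y}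

variable (𝕜 M) in
/-- A `3`-web on a surface: three foliations by curves (horizontal, vertical, transversal) in
general position, given by their tangent distributions `T^h`, `T^v`, `T^t`.  Pairwise
complementarity in the two-dimensional tangent spaces makes the three distributions
one-dimensional; a smooth one-dimensional distribution is always integrable, so it is the same
thing as a foliation by curves. -/
structure ThreeWeb where
  /-- tangent lines of the horizontal foliation -/
  hor : (x : M) → Submodule 𝕜 (TangentSpace 𝓘(𝕜, Plane 𝕜) x)
  /-- tangent lines of the vertical foliation -/
  ver : (x : M) → Submodule 𝕜 (TangentSpace 𝓘(𝕜, Plane 𝕜) x)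
  /-- tangent lines of the transversal foliation -/
  tra : (x : M) → Submodule 𝕜 (TangentSpace 𝓘(𝕜, Plane 𝕜) x)
  smooth_hor : IsSmoothLineField hor
  smooth_ver : IsSmoothLineField ver
  smooth_tra : IsSmoothLineField tra
  hor_ver : ∀ x, IsCompl (hor x) (ver x)
  hor_tra : ∀ x, IsCompl (hor x) (tra x)
  ver_tra : ∀ x, IsCompl (ver x) (tra x)

namespace ThreeWeb

variable (W : ThreeWeb 𝕜 M)

/-- The projection `h` onto `T^h` along `T^v`. -/
def h (x : M) : TangentSpace 𝓘(𝕜, Plane 𝕜) x →ₗ[𝕜] TangentSpace 𝓘(𝕜, Plane 𝕜) x :=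
  Submodule.projection _ _ (W.hor_ver x)

/-- The projection `v = id - h` onto `T^v` along `T^h`. -/
def v (x : M) : TangentSpace 𝓘(𝕜, Plane 𝕜) x →ₗ[𝕜] TangentSpace 𝓘(𝕜, Plane 𝕜) x :=
  LinearMap.id - W.h x

/-- The involution `j` which exchanges `T^h` and `T^v` and is `-id` on `T^t`: for `X` in `T^h`,
`j X` is the vector of `T^v` with `X - j X` in `T^t`, and for `X` in `T^v`, `j X` is the vector of
`T^h` with `X - j X` in `T^t`. -/
def j (x : M) : TangentSpace 𝓘(𝕜, Plane 𝕜) x →ₗ[𝕜] TangentSpace 𝓘(𝕜, Plane 𝕜) x :=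
  Submodule.projection _ _ (W.ver_tra x) ∘ₗ W.h x +
    Submodule.projection _ _ (W.hor_tra x) ∘ₗ W.v x

end ThreeWeb

variable (𝕜 M) in
/-- Linear connections on `M`.  For `cov : LinearConnection 𝕜 M`, `cov Y x u` is `∇_u Y` at `x`. -/
abbrev LinearConnection : Type _ :=
  CovariantDerivative 𝓘(𝕜, Plane 𝕜) (Plane 𝕜) (fun x : M => TangentSpace 𝓘(𝕜, Plane 𝕜) x)

/-- The curvature `R(X,Y)Z = ∇_X ∇_Y Z - ∇_Y ∇_X Z - ∇_[X,Y] Z`. -/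
def LinearConnection.curvature (cov : LinearConnection 𝕜 M)
    (X Y Z : (x : M) → TangentSpace 𝓘(𝕜, Plane 𝕜) x) (x : M) : TangentSpace 𝓘(𝕜, Plane 𝕜) x :=
  cov (fun y => cov Z y (Y y)) x (X x) - cov (fun y => cov Z y (X y)) x (Y x)
    - cov Z x (VectorField.mlieBracket 𝓘(𝕜, Plane 𝕜) X Y x)

/-- `cov` is the Chern connection of the web: the linear connection with `∇h = 0`, `∇j = 0` and
`T(hX, vY) = 0`, where `T` is the torsion. -/
structure ThreeWeb.IsChernConnection (W : ThreeWeb 𝕜 M) (cov : LinearConnection 𝕜 M) : Prop where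
  parallel_h : ∀ (Y : (x : M) → TangentSpace 𝓘(𝕜, Plane 𝕜) x) (x : M),
    MDifferentiableAt 𝓘(𝕜, Plane 𝕜) (𝓘(𝕜, Plane 𝕜).prod 𝓘(𝕜, Plane 𝕜))
      (fun x => (⟨x, Y x⟩ : TangentBundle 𝓘(𝕜, Plane 𝕜) M)) x →
    ∀ u, cov (fun y => W.h y (Y y)) x u = W.h x (cov Y x u)
  parallel_j : ∀ (Y : (x : M) → TangentSpace 𝓘(𝕜, Plane 𝕜) x) (x : M),
    MDifferentiableAt 𝓘(𝕜, Plane 𝕜) (𝓘(𝕜, Plane 𝕜).prod 𝓘(𝕜, Plane 𝕜))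
      (fun x => (⟨x, Y x⟩ : TangentBundle 𝓘(𝕜, Plane 𝕜) M)) x →
    ∀ u, cov (fun y => W.j y (Y y)) x u = W.j x (cov Y x u)
  torsion_eq_zero : ∀ (x : M) (X Y : TangentSpace 𝓘(𝕜, Plane 𝕜) x),
    cov.torsion x (W.h x X) (W.v x Y) = 0

/-! ### Adapted frames, tensors on `T^h` and their covariant derivatives -/

/-- A smooth frame `(e₁, e₂)` near `p` adapted to the web: `e₁` is a nonvanishing section of `T^h`
and `e₂ = j e₁`. -/
structure ThreeWeb.AdaptedFrame (W : ThreeWeb 𝕜 M) (p : M) where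
  /-- the horizontal field -/
  e₁ : (x : M) → TangentSpace 𝓘(𝕜, Plane 𝕜) x
  /-- the vertical field -/
  e₂ : (x : M) → TangentSpace 𝓘(𝕜, Plane 𝕜) x
  smooth₁ : SmoothFieldNear e₁ p
  smooth₂ : SmoothFieldNear e₂ p
  horizontal : ∀ᶠ y in 𝓝 p, e₁ y ∈ W.hor y
  ne_zero : ∀ᶠ y in 𝓝 p, e₁ y ≠ 0
  eq_j : ∀ᶠ y in 𝓝 p, e₂ y = W.j y (e₁ y)

namespace ThreeWeb.AdaptedFrame

variable {W : ThreeWeb 𝕜 M} {p : M} (e : W.AdaptedFrame p)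

/-- The frame, with its index written `1` or `2` (no other index is used). -/
def vec : ℕ → (x : M) → TangentSpace 𝓘(𝕜, Plane 𝕜) x
  | 1 => e.e₁
  | _ => e.e₂

/-- The coordinate `a` of a vector `X = a e₁` of `T^h`. -/
def coord (x : M) (X : TangentSpace 𝓘(𝕜, Plane 𝕜) x) : 𝕜 :=
  Classical.epsilon fun a : 𝕜 => X = a • e.e₁ x

/-- A tensor field `C` in `(T^h*)^{⊗m} ⊗ T^h` is identified with its component `c` in the frame,
`C(e₁, …, e₁) = c e₁` (so a tensor product of such tensors becomes a product of functions).  This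
is the component of the tensor field `C_i` in `(T^h*)^{⊗(m+1)} ⊗ T^h`,
`C_i(e₁, e₁, …, e₁) = (∇_{e_i} C)(e₁, …, e₁)
  = ∇_{e_i} (C(e₁, …, e₁)) - ∑ C(e₁, …, ∇_{e_i} e₁, …, e₁)`;
since `∇_{e_i} e₁` is a multiple of `e₁`, each of the `m` summands equals `c ∇_{e_i} e₁`. -/
def deriv (cov : LinearConnection 𝕜 M) (m : ℕ) (i : ℕ) (c : M → 𝕜) (x : M) : 𝕜 :=
  e.coord x (cov (fun y => c y • e.e₁ y) x (e.vec i x)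
    - (m : 𝕜) • c x • cov e.e₁ x (e.vec i x))

/-- Successive covariant derivatives `C_{i₁ i₂ … i_k} = (C_{i₂ … i_k})_{i₁}` of a tensor field `C` in
`(T^h*)^{⊗m} ⊗ T^h`. -/
def derivs (cov : LinearConnection 𝕜 M) (m : ℕ) (c : M → 𝕜) : List ℕ → M → 𝕜
  | [] => c
  | i :: l => e.deriv cov (m + l.length) i (derivs cov m c l)

/-- The component of the tensor `𝓡(hX, hY)hZ = R(jhX, hY)hZ`, where `R` is the curvature. -/
def curv (cov : LinearConnection 𝕜 M) (x : M) : 𝕜 :=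
  e.coord x (cov.curvature e.e₂ e.e₁ e.e₁ x)

/-- `e.R cov x [i₁, …, i_k]` is the component of `𝓡_{i₁ … i_k}` at `x`. -/
def R (cov : LinearConnection 𝕜 M) (x : M) (l : List ℕ) : 𝕜 := e.derivs cov 3 (e.curv cov) l x

/-- `e.S cov s x [i₁, …, i_k]` is the component of `s_{i₁ … i_k}` at `x`, for a section `s` of
`T^h* ⊗ T^h* ⊗ T^h` given by its component. -/
def S (cov : LinearConnection 𝕜 M) (s : M → 𝕜) (x : M) (l : List ℕ) : 𝕜 := e.derivs cov 2 s l x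

end ThreeWeb.AdaptedFrame

end Webs

/-! ### The polynomials

In this part `R` and `s` are families of scalars; `R l` and `s l` stand for the components of the
covariant derivatives `𝓡_l` and `s_l`, and `t` stands for `s` itself. -/

namespace WebPoly

variable {𝕜 : Type*} [RCLike 𝕜]

/-- First component of `P₂`. -/
def P2a (R s : List ℕ → 𝕜) : 𝕜 :=
  s [2,2] - (2 * s [2,1] - s [] * s [2] + 2 * s [] * s [1] + R [] * s [] + R [2])

/-- Second component of `P₂`. -/
def P2b (R s : List ℕ → 𝕜) : 𝕜 :=
  s [1,1] - (2 * s [2,1] - 2 * s [] * s [2] + s [] * s [1] + R [] * s [] + R [1])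

/-- The first obstruction `φ`. -/
def phi (R s : List ℕ → 𝕜) : 𝕜 :=
  -24 * R [] * s [2,1] - (24 * R [] * s [] + 12 * R [1] - 6 * R [2]) * s [1]
    + (24 * R [] * s [] + 6 * R [1] - 12 * R [2]) * s [2]
    + 3 * R [] * s [] ^ 3
    + (-3 * R [2,2] + R [2,1] + 2 * R [1,2] - 13 * R [] ^ 2 - 3 * R [1,1]) * s []
    + 2 * R [1,2,2] + R [2,2,1] - R [1,1,2] - 5 * R [] * R [1] - 2 * R [1,2,1]
    - 11 * R [] * R [2]

/-- Coefficient of `s₁` in `ψ¹`. -/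
def alpha (R : List ℕ → 𝕜) (t : 𝕜) : 𝕜 :=
  30 * R [] * t ^ 2 - 18 * R [2] * t
    - 3 / (4 * R []) * (-16 * R [] * R [2,2] + 14 * R [2] ^ 2 - 40 * R [] ^ 3
      - 56 * R [1] * R [2] + 40 * R [] * R [1,2] + 56 * R [1] ^ 2 - 40 * R [] * R [1,1])

/-- Coefficient of `s₂` in `ψ¹`. -/
def beta (R : List ℕ → 𝕜) (t : 𝕜) : 𝕜 :=
  3 / (4 * R []) * (24 * R [] * R [2] - 24 * R [] * R [1]) * t - 15 * R [] * t ^ 2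
    - 3 / (4 * R []) * (70 * R [1] * R [2] - 44 * R [] * R [1,2] + 20 * R [] * R [1,1]
      + 20 * R [] * R [2,2] - 28 * R [1] ^ 2 - 28 * R [2] ^ 2 - 60 * R [] ^ 3)

/-- Term of `ψ¹` free of `s₁` and `s₂`. -/
def gamma (R : List ℕ → 𝕜) (t : 𝕜) : 𝕜 :=
  -(3 / (4 * R [])) * (-6 * R [] * R [1] + 3 * R [] * R [2]) * t ^ 3
    - 3 / (4 * R []) * (7 * R [2] * R [1,2] + 12 * R [] * R [1,1,2] - 14 * R [1] * R [1,2]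
      - 7 * R [2] * R [2,2] + 14 * R [1] * R [1,1] - 8 * R [] * R [1,1,1]
      + 4 * R [] * R [2,2,2] - 47 * R [2] * R [] ^ 2 + 14 * R [1] * R [2,2]
      - 7 * R [1,1] * R [2] - 30 * R [1] * R [] ^ 2 - 12 * R [] * R [1,2,2]) * t
    - 3 / (4 * R []) * (-7 * R [2] * R [1,1,2] + 7 * R [2] * R [1,2,2]
      + 35 * R [1] * R [2] * R [] - 38 * R [1] ^ 2 * R [] - 2 * R [2] ^ 2 * R []
      + 12 * R [1,1,2,2] * R [] - 8 * R [1,1,1,2] * R [] - 4 * R [1,2,2,2] * R []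
      - 48 * R [] ^ 2 * R [1,2] + 8 * R [] ^ 2 * R [1,1] + 40 * R [] ^ 2 * R [2,2]
      + 8 * R [] ^ 4 - 14 * R [1] * R [1,2,2] + 14 * R [1] * R [1,1,2])

/-- Coefficient of `s₁` in `ψ²`. -/
def alphaHat (R : List ℕ → 𝕜) (t : 𝕜) : 𝕜 :=
  3 / (4 * R []) * (24 * R [] * R [2] - 24 * R [] * R [1]) * t - 15 * R [] * t ^ 2
    - 3 / (4 * R []) * (20 * R [] * R [2,2] + 70 * R [1] * R [2] - 28 * R [1] ^ 2
      + 60 * R [] ^ 3 - 28 * R [2] ^ 2 - 44 * R [] * R [2,1] + 20 * R [] * R [1,1])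

/-- Coefficient of `s₂` in `ψ²`. -/
def betaHat (R : List ℕ → 𝕜) (t : 𝕜) : 𝕜 :=
  30 * R [] * t ^ 2 + 18 * R [1] * t
    - 3 / (4 * R []) * (40 * R [] ^ 3 - 16 * R [] * R [1,1] - 56 * R [1] * R [2]
      + 56 * R [2] ^ 2 + 14 * R [1] ^ 2 + 40 * R [] * R [2,1] - 40 * R [] * R [2,2])

/-- Term of `ψ²` free of `s₁` and `s₂`. -/
def gammaHat (R : List ℕ → 𝕜) (t : 𝕜) : 𝕜 :=
  -(3 / (4 * R [])) * (3 * R [] * R [1] - 6 * R [] * R [2]) * t ^ 3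
    - 3 / (4 * R []) * (-7 * R [1] * R [2,2] - 14 * R [2] * R [2,1] + 12 * R [] * R [2,2,1]
      + 14 * R [1,1] * R [2] + 7 * R [1] * R [2,1] - 12 * R [] * R [2,1,1]
      - 8 * R [] * R [2,2,2] + 14 * R [2] * R [2,2] - 7 * R [1] * R [1,1]
      + 4 * R [] * R [1,1,1] + 30 * R [2] * R [] ^ 2 + 47 * R [1] * R [] ^ 2) * t
    - 3 / (4 * R []) * (35 * R [1] * R [2] * R [] - 7 * R [1] * R [2,1,1]
      + 7 * R [1] * R [2,2,1] + 8 * R [2,2,2,1] * R [] + 4 * R [2,1,1,1] * R []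
      - 12 * R [2,2,1,1] * R [] + 8 * R [] ^ 2 * R [2,2] - 2 * R [1] ^ 2 * R []
      + 40 * R [] ^ 2 * R [1,1] - 48 * R [] ^ 2 * R [2,1] - 38 * R [2] ^ 2 * R []
      - 8 * R [] ^ 4 + 14 * R [2] * R [2,1,1] - 14 * R [2] * R [2,2,1])

/-- The first component of the second obstruction `ψ¹`. -/
def psi1 (R s : List ℕ → 𝕜) : 𝕜 :=
  24 * R [] * s [2] ^ 2 - 48 * R [] * s [1] * s [2]
    + alpha R (s []) * s [1] + beta R (s []) * s [2] + gamma R (s [])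

/-- The second component of the second obstruction `ψ²`. -/
def psi2 (R s : List ℕ → 𝕜) : 𝕜 :=
  -24 * R [] * s [1] ^ 2 + 48 * R [] * s [1] * s [2]
    + alphaHat R (s []) * s [1] + betaHat R (s []) * s [2] + gammaHat R (s [])

end WebPoly

/-! ### Jets and formal solutions -/

section Formal

variable {𝕜 : Type*} [RCLike 𝕜] {M : Type*} [TopologicalSpace M] [ChartedSpace (Plane 𝕜) M]
  [IsManifold 𝓘(𝕜, Plane 𝕜) ∞ M]

/-- `f` and `g` have the same `k`-jet at `p`: in the preferred chart at `p` their derivatives up to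
order `k` agree. -/
def SameJet (k : ℕ) (f g : M → 𝕜) (p : M) : Prop :=
  ∀ i ≤ k,
    iteratedFDeriv 𝕜 i (f ∘ (extChartAt 𝓘(𝕜, Plane 𝕜) p).symm) (extChartAt 𝓘(𝕜, Plane 𝕜) p p) =
    iteratedFDeriv 𝕜 i (g ∘ (extChartAt 𝓘(𝕜, Plane 𝕜) p).symm) (extChartAt 𝓘(𝕜, Plane 𝕜) p p)

/-- The `k`-jet at `p` (`k ≥ 2`) of the section with component `s` is a formal solution of order
`k` of the second order operator `P_φ = (P₂, φ)`: the `(k-2)`-jet of `P_φ(s)` at `p` vanishes. -/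
def ThreeWeb.AdaptedFrame.IsFormalSolution {W : ThreeWeb 𝕜 M} {p : M} (e : W.AdaptedFrame p)
    (cov : LinearConnection 𝕜 M) (k : ℕ) (s : M → 𝕜) : Prop :=
  SameJet (k - 2) (fun x => WebPoly.P2a (e.R cov x) (e.S cov s x)) 0 p ∧
  SameJet (k - 2) (fun x => WebPoly.P2b (e.R cov x) (e.S cov s x)) 0 p ∧
  SameJet (k - 2) (fun x => WebPoly.phi (e.R cov x) (e.S cov s x)) 0 p

end Formal

end

/-! In an adapted frame the Chern connection reduces to one connection form, ∇e₁ = ω e₁, and a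
tensor in (T^h*)^{⊗m} ⊗ T^h with component c has C_i = e_i(c) − (m−1) ω_i c. Call m−1 its weight:
weights add under products, and each covariant derivative raises the weight by one. The components
of P₂ are homogeneous of weight 3 and φ is homogeneous of weight 5, so at a zero of these
expressions their ordinary and covariant derivatives agree. A formal solution of order 3 is
therefore one of order 2 at which six covariant derivatives, two for each equation, vanish as well
(`isFormalSolution_three_iff`).

By the Ricci identity (`derivs_one_two`) the third derivatives of s are, modulo lower order terms,
s_111, s_211, s_221 and s_222; they can be prescribed freely over a given 2-jet
(`exists_third_order`). Since 𝓡 ≠ 0, the two derivatives of φ = 0 determine s_211 and s_221; then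
one derivative of each component of P₂ determines s_111 and s_222. The two equations left over
contain no new unknown. Eliminating the third derivatives, and then the second derivatives through
P₂ = 0 and φ = 0, turns them, up to the factor 24𝓡, into ψ¹ = 0 and ψ² = 0 (`psi_eq_prolongation`).
As ψ¹ and ψ² depend only on the 2-jet (`S_eq_of_sameJet`), they are exactly the obstruction. -/

noncomputable section

/-! ### Smooth functions, smooth fields and Lie derivatives on a surface. -/

section Calculus

lemma natCast_le_infty (n : ℕ) : (n : ℕ∞ω) ≤ ∞ := by
  exact_mod_cast le_top

variable {𝕜 : Type*} [RCLike 𝕜] {M : Type*} [TopologicalSpace M] [ChartedSpace (Plane 𝕜) M]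
  {p : M}

namespace SmoothFunNear

variable {f g : M → 𝕜}

lemma eventually (hf : SmoothFunNear f p) : ∀ᶠ y in 𝓝 p, SmoothFunNear f y :=
  eventually_eventually_nhds.2 hf

lemma contMDiffAt (hf : SmoothFunNear f p) :
    ContMDiffAt 𝓘(𝕜, Plane 𝕜) 𝓘(𝕜, 𝕜) ∞ f p :=
  Eventually.self_of_nhds hf

lemma mdifferentiableAt (hf : SmoothFunNear f p) :
    MDifferentiableAt 𝓘(𝕜, Plane 𝕜) 𝓘(𝕜, 𝕜) f p :=
  hf.contMDiffAt.mdifferentiableAt (by simp)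

lemma const (c : 𝕜) : SmoothFunNear (fun _ : M => c) p :=
  Eventually.of_forall fun _ => contMDiffAt_const

lemma add (hf : SmoothFunNear f p) (hg : SmoothFunNear g p) :
    SmoothFunNear (fun x => f x + g x) p := by
  filter_upwards [hf, hg] with y h₁ h₂ using h₁.add h₂

lemma sub (hf : SmoothFunNear f p) (hg : SmoothFunNear g p) :
    SmoothFunNear (fun x => f x - g x) p := by
  filter_upwards [hf, hg] with y h₁ h₂ using h₁.sub h₂

lemma mul (hf : SmoothFunNear f p) (hg : SmoothFunNear g p) :
    SmoothFunNear (fun x => f x * g x) p := by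
  filter_upwards [hf, hg] with y h₁ h₂ using h₁.mul h₂

lemma congr (hf : SmoothFunNear f p) (h : g =ᶠ[𝓝 p] f) : SmoothFunNear g p := by
  filter_upwards [hf, h.eventuallyEq_nhds] with y h₁ h₂ using h₁.congr_of_eventuallyEq h₂

lemma inv (hf : SmoothFunNear f p) (h0 : ∀ᶠ y in 𝓝 p, f y ≠ 0) :
    SmoothFunNear (fun x => (f x)⁻¹) p := by
  filter_upwards [hf, h0] with y h₁ h₂
  exact ((contDiffAt_inv 𝕜 h₂).contMDiffAt).comp y h₁

end SmoothFunNear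

/-- The derivative of the function `f` along the vector field `X`. -/
def lieD (X : (x : M) → TangentSpace 𝓘(𝕜, Plane 𝕜) x) (f : M → 𝕜) (x : M) : 𝕜 :=
  mvfderiv 𝓘(𝕜, Plane 𝕜) f x (X x)

section lieD

variable {X Y : (x : M) → TangentSpace 𝓘(𝕜, Plane 𝕜) x} {f g : M → 𝕜}

lemma lieD_congr (h : f =ᶠ[𝓝 p] g) : lieD X f p = lieD X g p := by
  simp only [lieD, mvfderiv, h.mfderiv_eq]
  rfl

lemma lieD_const (c : 𝕜) : lieD X (fun _ => c) p = 0 := by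
  simp [lieD, mvfderiv_const]

lemma lieD_add (hf : SmoothFunNear f p) (hg : SmoothFunNear g p) :
    lieD X (fun x => f x + g x) p = lieD X f p + lieD X g p := by
  have := mvfderiv_add hf.mdifferentiableAt hg.mdifferentiableAt
  exact congr($this (X p))

lemma lieD_sub (hf : SmoothFunNear f p) (hg : SmoothFunNear g p) :
    lieD X (fun x => f x - g x) p = lieD X f p - lieD X g p := by
  have := mvfderiv_sub hf.mdifferentiableAt hg.mdifferentiableAt
  exact congr($this (X p))

lemma lieD_mul (hf : SmoothFunNear f p) (hg : SmoothFunNear g p) :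
    lieD X (fun x => f x * g x) p = lieD X f p * g p + f p * lieD X g p := by
  have := mvfderiv_mul hf.mdifferentiableAt hg.mdifferentiableAt
  refine (congr($this (X p))).trans ?_
  simp [lieD]
  ring

end lieD

variable [IsManifold 𝓘(𝕜, Plane 𝕜) ∞ M]

variable (𝕜 M) in
lemma isManifold_minSmoothness (n : ℕ) :
    IsManifold 𝓘(𝕜, Plane 𝕜) (minSmoothness 𝕜 n) M := by
  rw [minSmoothness_of_isRCLikeNormedField]
  exact IsManifold.of_le (n := ∞) (natCast_le_infty n)

namespace SmoothFieldNear

variable {X Y V : (x : M) → TangentSpace 𝓘(𝕜, Plane 𝕜) x}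

lemma eventually (hX : SmoothFieldNear X p) : ∀ᶠ y in 𝓝 p, SmoothFieldNear X y :=
  eventually_eventually_nhds.2 hX

lemma contMDiffAt (hX : SmoothFieldNear X p) :
    ContMDiffAt 𝓘(𝕜, Plane 𝕜) (𝓘(𝕜, Plane 𝕜).prod 𝓘(𝕜, Plane 𝕜)) ∞
      (fun x => (⟨x, X x⟩ : TangentBundle 𝓘(𝕜, Plane 𝕜) M)) p :=
  Eventually.self_of_nhds hX

lemma mdifferentiableAt (hX : SmoothFieldNear X p) :
    MDifferentiableAt 𝓘(𝕜, Plane 𝕜) (𝓘(𝕜, Plane 𝕜).prod 𝓘(𝕜, Plane 𝕜))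
      (fun x => (⟨x, X x⟩ : TangentBundle 𝓘(𝕜, Plane 𝕜) M)) p :=
  hX.contMDiffAt.mdifferentiableAt (by simp)

lemma smul {f : M → 𝕜} (hf : SmoothFunNear f p) (hX : SmoothFieldNear X p) :
    SmoothFieldNear (f • X) p := by
  filter_upwards [hf, hX] with y h₁ h₂ using h₁.smul_section h₂

lemma congr (hX : SmoothFieldNear X p) (h : ∀ᶠ y in 𝓝 p, Y y = X y) : SmoothFieldNear Y p := by
  filter_upwards [hX, eventually_eventually_nhds.2 h] with y h₁ h₂
  refine h₁.congr_of_eventuallyEq ?_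
  filter_upwards [h₂] with z hz
  rw [hz]

lemma mlieBracket (hX : SmoothFieldNear X p) (hY : SmoothFieldNear Y p) :
    SmoothFieldNear (VectorField.mlieBracket 𝓘(𝕜, Plane 𝕜) X Y) p := by
  filter_upwards [hX, hY] with y h₁ h₂
  have : IsManifold 𝓘(𝕜, Plane 𝕜) (((⊤ : ℕ∞) : ℕ∞ω) + 1) M := by simpa
  have := isManifold_minSmoothness 𝕜 M 2
  refine ContMDiffAt.mlieBracket_vectorField (n := ⊤) (m := ⊤) h₁ h₂ ?_
  simp [minSmoothness_of_isRCLikeNormedField]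

/-- The coordinates of a vector field in the trivialization of the tangent bundle at `p`. -/
def trivCoord (p : M) (X : (x : M) → TangentSpace 𝓘(𝕜, Plane 𝕜) x) (i : Fin 2) (x : M) : 𝕜 :=
  (trivializationAt (Plane 𝕜) (TangentSpace 𝓘(𝕜, Plane 𝕜)) p
    (⟨x, X x⟩ : TangentBundle 𝓘(𝕜, Plane 𝕜) M)).2 i

lemma eventually_mem_baseSet (𝕜 : Type*) [RCLike 𝕜] {M : Type*} [TopologicalSpace M]
    [ChartedSpace (Plane 𝕜) M] [IsManifold 𝓘(𝕜, Plane 𝕜) ∞ M] (p : M) :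
    ∀ᶠ y in 𝓝 p, y ∈ (trivializationAt (Plane 𝕜) (TangentSpace 𝓘(𝕜, Plane 𝕜)) p).baseSet :=
  ((trivializationAt (Plane 𝕜) (TangentSpace 𝓘(𝕜, Plane 𝕜)) p).open_baseSet).mem_nhds
    (FiberBundle.mem_baseSet_trivializationAt' p)

lemma smooth_trivCoord (hX : SmoothFieldNear X p) (i : Fin 2) :
    SmoothFunNear (trivCoord p X i) p := by
  filter_upwards [hX, eventually_mem_baseSet 𝕜 p] with y h₁ h₂
  have h := ((trivializationAt (Plane 𝕜) (TangentSpace 𝓘(𝕜, Plane 𝕜)) p).contMDiffAt_section_iff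
    h₂).1 h₁
  exact ((EuclideanSpace.proj (𝕜 := 𝕜) i).contDiff.contDiffAt.contMDiffAt).comp y h

lemma trivCoord_det {a b : 𝕜} {y : M}
    (hy : y ∈ (trivializationAt (Plane 𝕜) (TangentSpace 𝓘(𝕜, Plane 𝕜)) p).baseSet)
    (hV : V y = a • X y + b • Y y) (i : Fin 2) :
    trivCoord p V i y = a * trivCoord p X i y + b * trivCoord p Y i y := by
  have h := (trivializationAt (Plane 𝕜) (TangentSpace 𝓘(𝕜, Plane 𝕜)) p).linear 𝕜 hy
  unfold trivCoord
  rw [hV, h.map_add, h.map_smul, h.map_smul]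
  simp

lemma trivCoord_det_ne_zero {y : M}
    (hy : y ∈ (trivializationAt (Plane 𝕜) (TangentSpace 𝓘(𝕜, Plane 𝕜)) p).baseSet)
    (h : LinearIndependent 𝕜 ![X y, Y y]) :
    trivCoord p X 0 y * trivCoord p Y 1 y - trivCoord p X 1 y * trivCoord p Y 0 y ≠ 0 := by
  intro h0
  set T := (trivializationAt (Plane 𝕜) (TangentSpace 𝓘(𝕜, Plane 𝕜)) p).linearEquivAt 𝕜 y hy
  have hT : ∀ (Z : (x : M) → TangentSpace 𝓘(𝕜, Plane 𝕜) x) i, T (Z y) i = trivCoord p Z i y := by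
    intro Z i; rfl
  rw [LinearIndependent.pair_iff] at h
  -- The k-th coordinate of Yⁱ X − Xⁱ Y is 0 for k = i and ± the determinant otherwise.
  have key : ∀ i, T ((trivCoord p Y i y) • X y - (trivCoord p X i y) • Y y) = 0 := by
    intro i
    ext k
    simp only [map_sub, map_smul, PiLp.sub_apply, PiLp.smul_apply, hT, PiLp.zero_apply, smul_eq_mul]
    fin_cases i <;> fin_cases k <;> simp <;> first | ring1 | linear_combination h0 |
      linear_combination -h0
  have hz : ∀ i, trivCoord p Y i y = 0 ∧ trivCoord p X i y = 0 := by
    intro i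
    have := (T.map_eq_zero_iff).1 (key i)
    have := h (trivCoord p Y i y) (-trivCoord p X i y) (by rw [neg_smul, ← sub_eq_add_neg]; exact this)
    exact ⟨this.1, by simpa using this.2⟩
  have hX0 : T (X y) = 0 := by
    ext k; rw [hT, (hz k).2]; rfl
  have := h 1 0 (by simp [(T.map_eq_zero_iff).1 hX0])
  exact one_ne_zero this.1

/-- The coefficients of a smooth vector field in a smooth frame are smooth. -/
lemma smooth_coeff (hX : SmoothFieldNear X p) (hY : SmoothFieldNear Y p) (hV : SmoothFieldNear V p)
    (h : ∀ᶠ y in 𝓝 p, LinearIndependent 𝕜 ![X y, Y y]) {a b : M → 𝕜}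
    (hab : ∀ᶠ y in 𝓝 p, V y = a y • X y + b y • Y y) :
    SmoothFunNear a p ∧ SmoothFunNear b p := by
  have hd : ∀ᶠ y in 𝓝 p,
      trivCoord p X 0 y * trivCoord p Y 1 y - trivCoord p X 1 y * trivCoord p Y 0 y ≠ 0 := by
    filter_upwards [h, eventually_mem_baseSet 𝕜 p] with y h₁ h₂ using trivCoord_det_ne_zero h₂ h₁
  have hdi := ((((smooth_trivCoord hX 0).mul (smooth_trivCoord hY 1)).sub
    ((smooth_trivCoord hX 1).mul (smooth_trivCoord hY 0))).inv hd)
  -- Cramer's rule.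
  refine ⟨((((smooth_trivCoord hV 0).mul (smooth_trivCoord hY 1)).sub
    ((smooth_trivCoord hV 1).mul (smooth_trivCoord hY 0))).mul hdi).congr ?_,
    ((((smooth_trivCoord hX 0).mul (smooth_trivCoord hV 1)).sub
    ((smooth_trivCoord hX 1).mul (smooth_trivCoord hV 0))).mul hdi).congr ?_⟩ <;>
  · filter_upwards [hd, hab, eventually_mem_baseSet 𝕜 p] with y h₁ h₂ h₃
    rw [trivCoord_det h₃ h₂ 0, trivCoord_det h₃ h₂ 1, eq_mul_inv_iff_mul_eq₀ h₁]
    ring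

end SmoothFieldNear

section lieD

variable {X Y : (x : M) → TangentSpace 𝓘(𝕜, Plane 𝕜) x} {f g : M → 𝕜}

lemma mlieBracket_smul_right_eq (hf : SmoothFunNear f p) (hY : SmoothFieldNear Y p) :
    VectorField.mlieBracket 𝓘(𝕜, Plane 𝕜) X (f • Y) p =
      lieD X f p • Y p + f p • VectorField.mlieBracket 𝓘(𝕜, Plane 𝕜) X Y p :=
  VectorField.mlieBracket_smul_right hf.mdifferentiableAt hY.mdifferentiableAt

/-- Since [X, X] = 0, the Leibniz rule gives [X, fX] = (Xf) X, so Xf is a coefficient of a smooth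
field in a smooth frame. -/
lemma smooth_lieD (hX : SmoothFieldNear X p) (hY : SmoothFieldNear Y p)
    (h : ∀ᶠ y in 𝓝 p, LinearIndependent 𝕜 ![X y, Y y]) (hf : SmoothFunNear f p) :
    SmoothFunNear (lieD X f) p := by
  refine (SmoothFieldNear.smooth_coeff hX hY (hX.mlieBracket (hX.smul hf)) h
    (a := lieD X f) (b := fun _ => 0) ?_).1
  filter_upwards [hX.eventually, hf.eventually] with y h₁ h₂
  rw [mlieBracket_smul_right_eq h₂ h₁]
  simp

/-- The Lie bracket acts on functions as the commutator of derivatives. -/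
lemma lieD_mlieBracket (hX : SmoothFieldNear X p) (hY : SmoothFieldNear Y p)
    (hX0 : X p ≠ 0) (hf : SmoothFunNear f p) (hXf : SmoothFunNear (lieD X f) p)
    (hYf : SmoothFunNear (lieD Y f) p) :
    lieD (VectorField.mlieBracket 𝓘(𝕜, Plane 𝕜) X Y) f p =
      lieD X (lieD Y f) p - lieD Y (lieD X f) p := by
  have := isManifold_minSmoothness 𝕜 M 3
  have hle : minSmoothness 𝕜 2 ≤ (∞ : ℕ∞ω) := by
    rw [minSmoothness_of_isRCLikeNormedField]; exact natCast_le_infty 2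
  -- Expand the Jacobi identity for X, Y, fX by the Leibniz rule and subtract f times the one for X,
  -- Y, X. What remains is ([X,Y]f − XYf + YXf) X = 0, and X p ≠ 0.
  have jac := VectorField.leibniz_identity_mlieBracket_apply (hX.contMDiffAt.of_le hle)
    (hY.contMDiffAt.of_le hle) (hX.contMDiffAt.of_le hle)
  have jacf := VectorField.leibniz_identity_mlieBracket_apply (hX.contMDiffAt.of_le hle)
    (hY.contMDiffAt.of_le hle) ((hX.smul hf).contMDiffAt.of_le hle)
  have ev : ∀ Z : (x : M) → TangentSpace 𝓘(𝕜, Plane 𝕜) x,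
      VectorField.mlieBracket 𝓘(𝕜, Plane 𝕜) Z (f • X) =ᶠ[𝓝 p]
        lieD Z f • X + f • VectorField.mlieBracket 𝓘(𝕜, Plane 𝕜) Z X := by
    intro Z
    filter_upwards [hX.eventually, hf.eventually] with y h₁ h₂ using mlieBracket_smul_right_eq h₂ h₁
  have hYX := hY.mlieBracket hX
  rw [(EventuallyEq.refl _ X).mlieBracket_vectorField_eq (ev Y),
    (EventuallyEq.refl _ Y).mlieBracket_vectorField_eq (ev X),
    VectorField.mlieBracket_self, smul_zero, add_zero,
    VectorField.mlieBracket_add_right (hX.smul hYf).mdifferentiableAt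
      (hYX.smul hf).mdifferentiableAt,
    mlieBracket_smul_right_eq hYf hX, mlieBracket_smul_right_eq hf hYX,
    mlieBracket_smul_right_eq hf hX, mlieBracket_smul_right_eq hXf hX, jac,
    VectorField.mlieBracket_self, VectorField.mlieBracket_zero_right] at jacf
  have hz : (lieD (VectorField.mlieBracket 𝓘(𝕜, Plane 𝕜) X Y) f p -
      (lieD X (lieD Y f) p - lieD Y (lieD X f) p)) • X p = 0 := by
    simp only [Pi.zero_apply, smul_zero, add_zero] at jacf
    rw [sub_smul, sub_smul, sub_eq_zero]
    linear_combination (norm := module) -jacf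
  exact sub_eq_zero.1 ((smul_eq_zero.1 hz).resolve_right hX0)

end lieD

end Calculus

/-! ### The Chern connection in an adapted frame and the Ricci identity. -/

section Frame

variable {𝕜 : Type*} [RCLike 𝕜] {M : Type*} [TopologicalSpace M] [ChartedSpace (Plane 𝕜) M]
  [IsManifold 𝓘(𝕜, Plane 𝕜) ∞ M]

namespace ThreeWeb

variable (W : ThreeWeb 𝕜 M) {y : M} {X : TangentSpace 𝓘(𝕜, Plane 𝕜) y}

lemma h_mem : W.h y X ∈ W.hor y :=
  Submodule.projection_apply_mem _ _

lemma h_of_mem_hor (hX : X ∈ W.hor y) : W.h y X = X :=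
  Submodule.projection_apply_of_mem_left _ hX

lemma v_of_mem_ver (hX : X ∈ W.ver y) : W.v y X = X := by
  have : W.h y X = 0 := (Submodule.projection_apply_eq_zero_iff _).2 hX
  simp [v, this]

lemma j_of_mem_hor (hX : X ∈ W.hor y) :
    W.j y X = Submodule.projection _ _ (W.ver_tra y) X := by
  simp [j, v, W.h_of_mem_hor hX]

lemma j_mem_ver (hX : X ∈ W.hor y) : W.j y X ∈ W.ver y := by
  rw [W.j_of_mem_hor hX]
  exact Submodule.projection_apply_mem _ _

lemma j_ne_zero (hX : X ∈ W.hor y) (h0 : X ≠ 0) : W.j y X ≠ 0 := by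
  rw [W.j_of_mem_hor hX]
  intro h
  exact h0 (Submodule.disjoint_def.1 (W.hor_tra y).disjoint X hX
    ((Submodule.projection_apply_eq_zero_iff _).1 h))

end ThreeWeb

namespace ThreeWeb.AdaptedFrame

variable {W : ThreeWeb 𝕜 M} {p : M} (e : W.AdaptedFrame p)

lemma e₂_mem_ver : ∀ᶠ y in 𝓝 p, e.e₂ y ∈ W.ver y := by
  filter_upwards [e.horizontal, e.eq_j] with y h₁ h₂
  rw [h₂]; exact W.j_mem_ver h₁

lemma e₂_ne_zero : ∀ᶠ y in 𝓝 p, e.e₂ y ≠ 0 := by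
  filter_upwards [e.horizontal, e.eq_j, e.ne_zero] with y h₁ h₂ h₃
  rw [h₂]; exact W.j_ne_zero h₁ h₃

lemma linearIndependent : ∀ᶠ y in 𝓝 p, LinearIndependent 𝕜 ![e.e₁ y, e.e₂ y] := by
  filter_upwards [e.horizontal, e.ne_zero, e.e₂_mem_ver, e.e₂_ne_zero] with y h₁ h₂ h₃ h₄
  rw [LinearIndependent.pair_iff]
  intro a b hab
  have hd := Submodule.disjoint_def.1 (W.hor_ver y).disjoint (a • e.e₁ y)
    (Submodule.smul_mem _ _ h₁)
    (by rw [eq_neg_of_add_eq_zero_left hab]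
        exact Submodule.neg_mem _ (Submodule.smul_mem _ _ h₃))
  have ha : a = 0 := (smul_eq_zero.1 hd).resolve_right h₂
  refine ⟨ha, ?_⟩
  rw [hd, zero_add] at hab
  exact (smul_eq_zero.1 hab).resolve_right h₄

lemma exists_coeff : ∀ᶠ y in 𝓝 p, ∀ X : TangentSpace 𝓘(𝕜, Plane 𝕜) y,
    ∃ a b : 𝕜, X = a • e.e₁ y + b • e.e₂ y := by
  filter_upwards [e.linearIndependent] with y hy X
  have : FiniteDimensional 𝕜 (TangentSpace 𝓘(𝕜, Plane 𝕜) y) :=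
    inferInstanceAs (FiniteDimensional 𝕜 (Plane 𝕜))
  have hspan := hy.span_eq_top_of_card_eq_finrank' (by
    change Fintype.card (Fin 2) = Module.finrank 𝕜 (Plane 𝕜)
    simp)
  have hX : X ∈ Submodule.span 𝕜 (Set.range ![e.e₁ y, e.e₂ y]) := by rw [hspan]; trivial
  rw [Matrix.range_cons, Matrix.range_cons, Matrix.range_empty, Set.union_empty,
    Set.singleton_union, Submodule.mem_span_pair] at hX
  obtain ⟨a, b, hab⟩ := hX
  exact ⟨a, b, hab.symm⟩

/-- The coordinate is a choice, meaningful only on multiples of e₁; where e₁ ≠ 0 there is just one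
candidate. -/
lemma coord_smul {y : M} (hy : e.e₁ y ≠ 0) (a : 𝕜) : e.coord y (a • e.e₁ y) = a := by
  have h : a • e.e₁ y = e.coord y (a • e.e₁ y) • e.e₁ y :=
    Classical.epsilon_spec (p := fun b : 𝕜 => a • e.e₁ y = b • e.e₁ y) ⟨a, rfl⟩
  exact (smul_left_injective 𝕜 hy h).symm

lemma eq_coord_smul : ∀ᶠ y in 𝓝 p, ∀ X ∈ W.hor y, X = e.coord y X • e.e₁ y := by
  filter_upwards [e.exists_coeff, e.horizontal, e.ne_zero, e.e₂_mem_ver, e.e₂_ne_zero]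
    with y h h₁ h₂ h₃ h₄ X hX
  obtain ⟨a, b, hab⟩ := h X
  have hb : b • e.e₂ y = X - a • e.e₁ y := by rw [hab]; abel
  have hd := Submodule.disjoint_def.1 (W.hor_ver y).disjoint (b • e.e₂ y)
    (by rw [hb]; exact Submodule.sub_mem _ hX (Submodule.smul_mem _ _ h₁))
    (Submodule.smul_mem _ _ h₃)
  rw [hd, add_zero] at hab
  rw [hab, e.coord_smul h₂]

/-- The derivative along a vector of the frame. -/
def L (i : ℕ) : (M → 𝕜) → M → 𝕜 := lieD (e.vec i)

variable {f g : M → 𝕜}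

lemma smooth_L (i : ℕ) (hf : SmoothFunNear f p) : SmoothFunNear (e.L i f) p := by
  by_cases hi : i = 1
  · subst hi
    exact smooth_lieD e.smooth₁ e.smooth₂ e.linearIndependent hf
  -- Every index other than 1 falls into the default branch, so it also denotes e₂.
  · have : e.vec i = e.e₂ := by
      unfold vec; split
      · exact absurd rfl hi
      · rfl
    rw [L, this]
    refine smooth_lieD e.smooth₂ e.smooth₁ ?_ hf
    filter_upwards [e.linearIndependent] with y hy
    rw [LinearIndependent.pair_symm_iff]
    exact hy

variable (cov : LinearConnection 𝕜 M)

/-- The component of the connection form: `∇_{e_i} e₁ = ω_i e₁`. -/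
def conn (i : ℕ) (x : M) : 𝕜 := e.coord x (cov e.e₁ x (e.vec i x))

variable {cov}

lemma cov_congr {Y Z : (x : M) → TangentSpace 𝓘(𝕜, Plane 𝕜) x} (hY : SmoothFieldNear Y p)
    (h : ∀ᶠ y in 𝓝 p, Y y = Z y) : cov Y p = cov Z p :=
  cov.isCovariantDerivativeOn.congr_of_eventuallyEq hY.mdifferentiableAt
    (hY.congr (h.mono fun _ h => h.symm)).mdifferentiableAt univ_mem h

/-- ∇h = 0 makes T^h parallel: ∇e₁ = ∇(h e₁) = h ∇e₁. -/
lemma cov_e₁ (hcov : W.IsChernConnection cov) : ∀ᶠ y in 𝓝 p, ∀ u, cov e.e₁ y u = e.coord y (cov e.e₁ y u) • e.e₁ y := by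
  filter_upwards [e.eq_coord_smul, e.smooth₁.eventually, eventually_eventually_nhds.2 e.horizontal]
    with y h₁ h₂ h₃ u
  apply h₁
  have := hcov.parallel_h e.e₁ y h₂.mdifferentiableAt u
  rw [← cov_congr h₂ (h₃.mono fun z hz => (W.h_of_mem_hor hz).symm)] at this
  rw [this]
  exact W.h_mem

/-- ∇j = 0 and e₂ = j e₁ give e₂ the same connection form as e₁. -/
lemma cov_e₂ (hcov : W.IsChernConnection cov) :
    ∀ᶠ y in 𝓝 p, ∀ u, cov e.e₂ y u = e.coord y (cov e.e₁ y u) • e.e₂ y := by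
  filter_upwards [e.cov_e₁ hcov, e.smooth₁.eventually, e.smooth₂.eventually,
    eventually_eventually_nhds.2 e.eq_j] with y h₁ h₂ h₃ h₄ u
  have := hcov.parallel_j e.e₁ y h₂.mdifferentiableAt u
  rw [← cov_congr h₃ h₄, h₁ u, map_smul, ← h₄.self_of_nhds] at this
  exact this

/-- Vanishing torsion on (T^h, T^v) reads [e₁, e₂] = ∇_{e₁} e₂ − ∇_{e₂} e₁. -/
lemma mlieBracket_eq (hcov : W.IsChernConnection cov) :
    ∀ᶠ y in 𝓝 p, VectorField.mlieBracket 𝓘(𝕜, Plane 𝕜) e.e₁ e.e₂ y =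
      (-e.conn cov 2 y) • e.e₁ y + e.conn cov 1 y • e.e₂ y := by
  filter_upwards [e.cov_e₁ hcov, e.cov_e₂ hcov, e.smooth₁.eventually, e.smooth₂.eventually,
    e.horizontal, e.e₂_mem_ver] with y h₁ h₂ h₃ h₄ h₅ h₆
  have ht := hcov.torsion_eq_zero y (e.e₁ y) (e.e₂ y)
  rw [W.h_of_mem_hor h₅, W.v_of_mem_ver h₆,
    cov.torsion_apply h₃.mdifferentiableAt h₄.mdifferentiableAt, h₁, h₂] at ht
  rw [← sub_eq_zero.1 ht]
  simp only [conn, vec]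
  module

/-- Smoothness of the connection is not among the hypotheses: up to sign, ω₁ and ω₂ are the
coefficients of the smooth field [e₁, e₂] in the frame. -/
lemma smooth_conn (hcov : W.IsChernConnection cov) (i : ℕ) : SmoothFunNear (e.conn cov i) p := by
  have h := SmoothFieldNear.smooth_coeff e.smooth₁ e.smooth₂ (e.smooth₁.mlieBracket e.smooth₂)
    e.linearIndependent (e.mlieBracket_eq hcov)
  by_cases hi : i = 1
  · subst hi; exact h.2
  · have : e.conn cov i = e.conn cov 2 := by
      unfold conn vec; split
      · exact absurd rfl hi
      · rfl
    rw [this]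
    simpa using (SmoothFunNear.const 0).sub h.1

lemma cov_smul_eventually {c : M → 𝕜} (hcov : W.IsChernConnection cov) (hc : SmoothFunNear c p)
    (i : ℕ) : ∀ᶠ y in 𝓝 p, cov (fun y => c y • e.e₁ y) y (e.vec i y) =
      (e.L i c y + e.conn cov i y * c y) • e.e₁ y := by
  filter_upwards [e.cov_e₁ hcov, e.smooth₁.eventually, hc.eventually] with y h₁ h₂ h₃
  have := congr($(cov.isCovariantDerivativeOn.leibniz h₂.mdifferentiableAt
    h₃.mdifferentiableAt (Set.mem_univ y)) (e.vec i y))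
  refine this.trans ?_
  change c y • cov e.e₁ y (e.vec i y) + e.L i c y • e.e₁ y = _
  rw [h₁]
  simp only [conn]
  module

/-- Each of the m covariant slots contributes −ω_i c and the value in T^h contributes +ω_i c. -/
lemma deriv_eq {c : M → 𝕜} (hcov : W.IsChernConnection cov) (hc : SmoothFunNear c p) (m i : ℕ) :
    e.deriv cov m i c =ᶠ[𝓝 p] fun y => e.L i c y - (m - 1) * (e.conn cov i y * c y) := by
  filter_upwards [e.cov_smul_eventually hcov hc i, e.cov_e₁ hcov, e.ne_zero] with y h₁ h₂ h₃
  have h : cov (fun y => c y • e.e₁ y) y (e.vec i y) - (m : 𝕜) • c y • cov e.e₁ y (e.vec i y) =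
      (e.L i c y - (m - 1) * (e.conn cov i y * c y)) • e.e₁ y := by
    rw [h₁, h₂]
    simp only [conn]
    module
  rw [deriv, h, e.coord_smul h₃]

lemma smooth_derivs {c : M → 𝕜} (hcov : W.IsChernConnection cov) (hc : SmoothFunNear c p) (m : ℕ)
    (l : List ℕ) : SmoothFunNear (e.derivs cov m c l) p := by
  induction l with
  | nil => exact hc
  | cons i l ih =>
    exact ((e.smooth_L i ih).sub ((SmoothFunNear.const _).mul
      ((e.smooth_conn hcov i).mul ih))).congr (e.deriv_eq hcov ih _ i)

lemma derivs_cons {c : M → 𝕜} (hcov : W.IsChernConnection cov) (hc : SmoothFunNear c p) (m i : ℕ)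
    (l : List ℕ) : e.derivs cov m c (i :: l) =ᶠ[𝓝 p] fun y => e.L i (e.derivs cov m c l) y -
      (m + l.length - 1) * (e.conn cov i y * e.derivs cov m c l y) := by
  have := e.deriv_eq hcov (e.smooth_derivs hcov hc m l) (m + l.length) i
  push_cast at this
  exact this

lemma L_add {i : ℕ} (hf : SmoothFunNear f p) (hg : SmoothFunNear g p) :
    e.L i (fun x => f x + g x) p = e.L i f p + e.L i g p := lieD_add hf hg

lemma L_sub {i : ℕ} (hf : SmoothFunNear f p) (hg : SmoothFunNear g p) :
    e.L i (fun x => f x - g x) p = e.L i f p - e.L i g p := lieD_sub hf hg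

lemma L_mul {i : ℕ} (hf : SmoothFunNear f p) (hg : SmoothFunNear g p) :
    e.L i (fun x => f x * g x) p = e.L i f p * g p + f p * e.L i g p := lieD_mul hf hg

/-- On a line bundle the quadratic terms in ω cancel; those of ∇ along [e₂, e₁] = ω₂ e₁ − ω₁ e₂
cancel among themselves too. -/
lemma curv_eq (hcov : W.IsChernConnection cov) :
    e.curv cov =ᶠ[𝓝 p] fun y => e.L 2 (e.conn cov 1) y - e.L 1 (e.conn cov 2) y := by
  have hc : ∀ i, ∀ᶠ y in 𝓝 p, e.conn cov i y • e.e₁ y = cov e.e₁ y (e.vec i y) := fun i => by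
    filter_upwards [e.cov_e₁ hcov] with y h₁ using (h₁ _).symm
  have hs : ∀ i, SmoothFieldNear (fun y => e.conn cov i y • e.e₁ y) p := fun i =>
    (SmoothFieldNear.smul (e.smooth_conn hcov i) e.smooth₁)
  filter_upwards [e.cov_smul_eventually hcov (e.smooth_conn hcov 1) 2,
    e.cov_smul_eventually hcov (e.smooth_conn hcov 2) 1, eventually_eventually_nhds.2 (hc 1),
    eventually_eventually_nhds.2 (hc 2), (hs 1).eventually, (hs 2).eventually, e.cov_e₁ hcov,
    e.ne_zero, e.mlieBracket_eq hcov] with y h₁ h₂ h₃ h₄ h₅ h₆ h₇ h₈ h₉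
  have h : cov.curvature e.e₂ e.e₁ e.e₁ y =
      (e.L 2 (e.conn cov 1) y - e.L 1 (e.conn cov 2) y) • e.e₁ y := by
    have e₁' : cov (fun y => cov e.e₁ y (e.e₁ y)) y (e.e₂ y) = _ :=
      congr($(cov_congr h₅ h₃) (e.vec 2 y)).symm.trans h₁
    have e₂' : cov (fun y => cov e.e₁ y (e.e₂ y)) y (e.e₁ y) = _ :=
      congr($(cov_congr h₆ h₄) (e.vec 1 y)).symm.trans h₂
    have c₁ : cov e.e₁ y (e.e₁ y) = e.conn cov 1 y • e.e₁ y := h₇ _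
    have c₂ : cov e.e₁ y (e.e₂ y) = e.conn cov 2 y • e.e₁ y := h₇ _
    rw [LinearConnection.curvature, e₁', e₂', VectorField.mlieBracket_swap_apply, h₉, map_neg,
      map_add, map_smul, map_smul, c₁, c₂]
    module
  rw [curv, h, e.coord_smul h₈]

lemma smooth_curv (hcov : W.IsChernConnection cov) : SmoothFunNear (e.curv cov) p :=
  ((e.smooth_L 2 (e.smooth_conn hcov 1)).sub (e.smooth_L 1 (e.smooth_conn hcov 2))).congr
    (e.curv_eq hcov)

lemma L_commutator (hcov : W.IsChernConnection cov) (hf : SmoothFunNear f p) :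
    ∀ᶠ y in 𝓝 p, e.L 1 (e.L 2 f) y - e.L 2 (e.L 1 f) y =
      e.conn cov 1 y * e.L 2 f y - e.conn cov 2 y * e.L 1 f y := by
  filter_upwards [e.mlieBracket_eq hcov, e.smooth₁.eventually, e.smooth₂.eventually, e.ne_zero,
    hf.eventually, (e.smooth_L 1 hf).eventually, (e.smooth_L 2 hf).eventually]
    with y h₁ h₂ h₃ h₄ h₅ h₆ h₇
  refine (lieD_mlieBracket h₂ h₃ h₄ h₅ h₆ h₇).symm.trans ?_
  rw [lieD, h₁, map_add, map_smul, map_smul]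
  change -e.conn cov 2 y * e.L 1 f y + e.conn cov 1 y * e.L 2 f y = _
  ring

/-- The outer connection term carries m + |l|, one more than the inner one, because the first
differentiation adds a slot. -/
lemma derivs_cons_cons {c : M → 𝕜} (hcov : W.IsChernConnection cov) (hc : SmoothFunNear c p)
    (m j i : ℕ) (l : List ℕ) : ∀ᶠ y in 𝓝 p, e.derivs cov m c (j :: i :: l) y =
      e.L j (e.L i (e.derivs cov m c l)) y - (m + l.length - 1) *
        (e.L j (e.conn cov i) y * e.derivs cov m c l y +
          e.conn cov i y * e.L j (e.derivs cov m c l) y) - (m + l.length) * (e.conn cov j y *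
        (e.L i (e.derivs cov m c l) y -
          (m + l.length - 1) * (e.conn cov i y * e.derivs cov m c l y))) := by
  have hf := e.smooth_derivs hcov hc m l
  filter_upwards [e.derivs_cons hcov hc m j (i :: l),
    (e.derivs_cons hcov hc m i l).eventuallyEq_nhds, hf.eventually,
    (e.smooth_L i hf).eventually, (e.smooth_conn hcov i).eventually] with y h₁ h₂ h₃ h₄ h₅
  rw [h₁, h₂.self_of_nhds, L, lieD_congr h₂, lieD_sub h₄ ((SmoothFunNear.const _).mul
    (h₅.mul h₃)), lieD_mul (SmoothFunNear.const _) (h₅.mul h₃), lieD_const, lieD_mul h₅ h₃,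
    List.length_cons]
  push_cast
  simp only [L]
  ring

/-- The Ricci identity: `C_{12} - C_{21} = (m - 1) 𝓡 C` for `C` in `(T^h*)^{⊗m} ⊗ T^h`. -/
lemma derivs_one_two {c : M → 𝕜} (hcov : W.IsChernConnection cov) (hc : SmoothFunNear c p) (m : ℕ)
    (l : List ℕ) : e.derivs cov m c (1 :: 2 :: l) =ᶠ[𝓝 p] fun y =>
      e.derivs cov m c (2 :: 1 :: l) y + (m + l.length - 1) *
        (e.curv cov y * e.derivs cov m c l y) := by
  filter_upwards [e.derivs_cons_cons hcov hc m 1 2 l, e.derivs_cons_cons hcov hc m 2 1 l,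
    e.L_commutator hcov (e.smooth_derivs hcov hc m l), e.curv_eq hcov] with y h₁ h₂ h₃ h₄
  rw [h₁, h₂, h₄]
  -- With w = m + |l| − 1, the derivatives of ω give w𝓡f. The first order terms left are −(ω₁ e₂f −
  -- ω₂ e₁f), and the commutator of e₁ and e₂ cancels them.
  linear_combination h₃

end ThreeWeb.AdaptedFrame

end Frame

/-! ### Elimination: the obstruction polynomials from the differentiated equations. -/

namespace WebPoly

variable {𝕜 : Type*} [RCLike 𝕜]

/-- Component of the covariant derivative of the first component of `P₂` along `e_i`. -/
def P2aCov (R s : List ℕ → 𝕜) (i : ℕ) : 𝕜 :=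
  s [i,2,2] - (2 * s [i,2,1] - (s [i] * s [2] + s [] * s [i,2])
    + 2 * (s [i] * s [1] + s [] * s [i,1]) + (R [i] * s [] + R [] * s [i]) + R [i,2])

/-- Component of the covariant derivative of the second component of `P₂` along `e_i`. -/
def P2bCov (R s : List ℕ → 𝕜) (i : ℕ) : 𝕜 :=
  s [i,1,1] - (2 * s [i,2,1] - 2 * (s [i] * s [2] + s [] * s [i,2])
    + (s [i] * s [1] + s [] * s [i,1]) + (R [i] * s [] + R [] * s [i]) + R [i,1])

/-- Component of the covariant derivative of `φ` along `e_i`. -/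
def phiCov (R s : List ℕ → 𝕜) (i : ℕ) : 𝕜 :=
  -24 * (R [i] * s [2,1] + R [] * s [i,2,1])
    - ((24 * (R [i] * s [] + R [] * s [i]) + 12 * R [i,1] - 6 * R [i,2]) * s [1]
      + (24 * R [] * s [] + 12 * R [1] - 6 * R [2]) * s [i,1])
    + ((24 * (R [i] * s [] + R [] * s [i]) + 6 * R [i,1] - 12 * R [i,2]) * s [2]
      + (24 * R [] * s [] + 6 * R [1] - 12 * R [2]) * s [i,2])
    + 3 * (R [i] * s [] ^ 3 + R [] * (3 * s [] ^ 2 * s [i]))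
    + ((-3 * R [i,2,2] + R [i,2,1] + 2 * R [i,1,2] - 26 * R [] * R [i] - 3 * R [i,1,1]) * s []
      + (-3 * R [2,2] + R [2,1] + 2 * R [1,2] - 13 * R [] ^ 2 - 3 * R [1,1]) * s [i])
    + 2 * R [i,1,2,2] + R [i,2,2,1] - R [i,1,1,2] - 5 * (R [i] * R [1] + R [] * R [i,1])
    - 2 * R [i,1,2,1] - 11 * (R [i] * R [2] + R [] * R [i,2])

/-- The families of covariant derivatives up to a Ricci identity: `c` has weight `w`. -/
structure IsRicciFamily (R : List ℕ → 𝕜) (w : 𝕜) (c : List ℕ → 𝕜) : Prop where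
  comm : ∀ l, c (1 :: 2 :: l) = c (2 :: 1 :: l) + (w + l.length) * (R [] * c l)
  comm_cons : ∀ i l, c (i :: 1 :: 2 :: l) = c (i :: 2 :: 1 :: l) +
    (w + l.length) * (R [i] * c l + R [] * c (i :: l))
  comm_cons_cons : ∀ j i l, c (j :: i :: 1 :: 2 :: l) = c (j :: i :: 2 :: 1 :: l) +
    (w + l.length) * (R [j, i] * c l + R [i] * c (j :: l) +
      (R [j] * c (i :: l) + R [] * c (j :: i :: l)))

section

variable {R s : List ℕ → 𝕜}

/-- These are the two differentiated equations not used to solve for third derivatives. Their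
leading parts s_122 − 2 s_121 and s_211 − 2 s_221 are, modulo lower order, combinations of those of
φ_1 and φ_2, namely −24𝓡 s_121 and −24𝓡 s_221. -/
lemma psi_eq_prolongation (h0 : R [] ≠ 0) (ha : P2a R s = 0) (hb : P2b R s = 0) (hφ : phi R s = 0)
    (h1 : phiCov R s 1 = 0) (h2 : phiCov R s 2 = 0) (hR : IsRicciFamily R 2 R)
    (hs : IsRicciFamily R 1 s) :
    24 * R [] * P2aCov R s 1 = psi1 R s ∧ 24 * R [] * P2bCov R s 2 = psi2 R s := by
  have R12 := hR.comm []
  have R121 := hR.comm [1]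
  have R122 := hR.comm [2]
  have R212 := hR.comm_cons 2 []
  have R112 := hR.comm_cons 1 []
  have R1211 := hR.comm [1, 1]
  have R1212 := hR.comm [1, 2]
  have R1221 := hR.comm [2, 1]
  have R1222 := hR.comm [2, 2]
  have R1121 := hR.comm_cons 1 [1]
  have R1122 := hR.comm_cons 1 [2]
  have R2121 := hR.comm_cons 2 [1]
  have R2122 := hR.comm_cons 2 [2]
  have R1112 := hR.comm_cons_cons 1 1 []
  have R2112 := hR.comm_cons_cons 2 1 []
  have R2212 := hR.comm_cons_cons 2 2 []
  have S12 := hs.comm []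
  have S121 := hs.comm [1]
  have S122 := hs.comm [2]
  have S212 := hs.comm_cons 2 []
  simp only [List.length_cons, List.length_nil] at *
  norm_num at *
  have s22 : s [2,2] = 2 * s [2,1] - s [] * s [2] + 2 * s [] * s [1] + R [] * s [] + R [2] := by
    unfold P2a at ha; linear_combination ha
  have s11 : s [1,1] = 2 * s [2,1] - 2 * s [] * s [2] + s [] * s [1] + R [] * s [] + R [1] := by
    unfold P2b at hb; linear_combination hb
  unfold phi at hφ
  unfold phiCov at h1 h2
  unfold P2aCov P2bCov psi1 psi2 alpha beta gamma alphaHat betaHat gammaHat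
  -- The Ricci identities move every index 2 to the left of every 1, and P₂ = 0 removes s_22 and
  -- s_11; among second and higher derivatives of s only s_21, s_121 (in the form s_211) and s_221
  -- survive.
  simp only [R1212, R1211, R1221, R1222, R1122, R1121, R1112, R2112, R2212, R2121, R2122, R112,
    R212, R121, R122, R12, S12, S121, S122, S212, s22, s11] at hφ h1 h2 ⊢
  constructor
  -- 2φ_1 − φ_2 matches the third order terms. The terms (84𝓡_1 − 42𝓡_2) s_21 that remain are
  -- removed by φ, whose leading term is −24𝓡 s_21; hence the factors 7/2 and 7/4. The second
  -- identity is the mirror image.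
  · linear_combination (norm := (field_simp; ring)) 2 * h1 - h2 +
      (-7 / 2 * (R [1] / R []) + 7 / 4 * (R [2] / R [])) * hφ
  · linear_combination (norm := (field_simp; ring)) 2 * h2 - h1 +
      (7 / 4 * (R [1] / R []) - 7 / 2 * (R [2] / R [])) * hφ

end

end WebPoly

/-! ### Covariant product rules and the covariant derivatives of the operator. -/

section FrameAlgebra

variable {𝕜 : Type*} [RCLike 𝕜] {M : Type*} [TopologicalSpace M] [ChartedSpace (Plane 𝕜) M]
  [IsManifold 𝓘(𝕜, Plane 𝕜) ∞ M]

namespace ThreeWeb.AdaptedFrame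

variable {W : ThreeWeb 𝕜 M} {p : M} (e : W.AdaptedFrame p) {cov : LinearConnection 𝕜 M}

lemma L_derivs {c : M → 𝕜} (hcov : W.IsChernConnection cov) (hc : SmoothFunNear c p) (m i : ℕ)
    (l : List ℕ) : e.L i (e.derivs cov m c l) =ᶠ[𝓝 p] fun y => e.derivs cov m c (i :: l) y +
      (m + l.length - 1) * (e.conn cov i y * e.derivs cov m c l y) := by
  filter_upwards [e.derivs_cons hcov hc m i l] with y hy
  rw [hy]; ring

lemma L_derivs_mul_derivs {c d : M → 𝕜} (hcov : W.IsChernConnection cov)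
    (hc : SmoothFunNear c p) (hd : SmoothFunNear d p) (m n i : ℕ) (l k : List ℕ) :
    e.L i (fun y => e.derivs cov m c l y * e.derivs cov n d k y) =ᶠ[𝓝 p] fun y =>
      e.derivs cov m c (i :: l) y * e.derivs cov n d k y +
      e.derivs cov m c l y * e.derivs cov n d (i :: k) y + (m + l.length + n + k.length - 2) *
      (e.conn cov i y * (e.derivs cov m c l y * e.derivs cov n d k y)) := by
  filter_upwards [e.L_derivs hcov hc m i l, e.L_derivs hcov hd n i k,
    (e.smooth_derivs hcov hc m l).eventually, (e.smooth_derivs hcov hd n k).eventually]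
    with y h₁ h₂ h₃ h₄
  rw [L] at h₁ h₂ ⊢
  rw [lieD_mul h₃ h₄, h₁, h₂]
  ring

/-- Differentiates an identity such as the Ricci identity: l and k have equal length, so both sides
get the same connection term. -/
lemma derivs_cons_congr {c T : M → 𝕜} (hcov : W.IsChernConnection cov) (hc : SmoothFunNear c p)
    (hT : SmoothFunNear T p) (m i : ℕ) {l k : List ℕ} (hlk : l.length = k.length) (a : 𝕜)
    (h : e.derivs cov m c l =ᶠ[𝓝 p] fun y => e.derivs cov m c k y + a * T y) :
    e.derivs cov m c (i :: l) =ᶠ[𝓝 p] fun y => e.derivs cov m c (i :: k) y +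
      a * (e.L i T y - (m + l.length - 1) * (e.conn cov i y * T y)) := by
  filter_upwards [e.derivs_cons hcov hc m i l, e.derivs_cons hcov hc m i k, h.eventuallyEq_nhds,
    hT.eventually, (e.smooth_derivs hcov hc m k).eventually] with y h₁ h₂ h₃ h₄ h₅
  rw [h₁, h₂, h₃.self_of_nhds, L, lieD_congr h₃, lieD_add h₅ ((SmoothFunNear.const a).mul h₄),
    lieD_mul (SmoothFunNear.const a) h₄, lieD_const, hlk]
  ring

/-- The identities with extra leading indices are covariant derivatives of the Ricci identity. The
connection terms cancel because 𝓡C has the weight of the second derivatives of C. -/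
lemma isRicciFamily {c : M → 𝕜} (hcov : W.IsChernConnection cov) (hc : SmoothFunNear c p) (m : ℕ) :
    WebPoly.IsRicciFamily (e.R cov p) (m - 1 : 𝕜) (fun l => e.derivs cov m c l p) := by
  have hr := e.smooth_curv hcov
  have sR : ∀ l, SmoothFunNear (e.derivs cov 3 (e.curv cov) l) p := e.smooth_derivs hcov hr 3
  have sc : ∀ l, SmoothFunNear (e.derivs cov m c l) p := e.smooth_derivs hcov hc m
  have comm : ∀ l, e.derivs cov m c (1 :: 2 :: l) =ᶠ[𝓝 p] fun y =>
      e.derivs cov m c (2 :: 1 :: l) y + (m - 1 + l.length) *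
        (e.derivs cov 3 (e.curv cov) [] y * e.derivs cov m c l y) := fun l => by
    filter_upwards [e.derivs_one_two hcov hc m l] with y hy
    rw [hy, derivs]; ring
  have comm_cons : ∀ i l, e.derivs cov m c (i :: 1 :: 2 :: l) =ᶠ[𝓝 p] fun y =>
      e.derivs cov m c (i :: 2 :: 1 :: l) y + (m - 1 + l.length) *
        (e.derivs cov 3 (e.curv cov) [i] y * e.derivs cov m c l y +
          e.derivs cov 3 (e.curv cov) [] y * e.derivs cov m c (i :: l) y) := fun i l => by
    filter_upwards [e.derivs_cons_congr hcov hc ((sR []).mul (sc l)) m i (by simp) _ (comm l),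
      e.L_derivs_mul_derivs hcov hr hc 3 m i [] l] with y h₁ h₂
    rw [h₁, h₂]
    simp only [List.length_cons, List.length_nil]
    push_cast
    ring
  refine ⟨fun l => (comm l).self_of_nhds, fun i l => (comm_cons i l).self_of_nhds,
    fun j i l => ?_⟩
  refine ((e.derivs_cons_congr hcov hc (((sR [i]).mul (sc l)).add ((sR []).mul (sc (i :: l))))
    m j (by simp) _ (comm_cons i l)).self_of_nhds).trans ?_
  beta_reduce
  rw [e.L_add ((sR [i]).mul (sc l)) ((sR []).mul (sc (i :: l))),
    (e.L_derivs_mul_derivs hcov hr hc 3 m j [i] l).self_of_nhds,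
    (e.L_derivs_mul_derivs hcov hr hc 3 m j [] (i :: l)).self_of_nhds]
  simp only [List.length_cons, List.length_nil, R]
  push_cast
  ring

lemma isRicciFamily_R (hcov : W.IsChernConnection cov) :
    WebPoly.IsRicciFamily (e.R cov p) 2 (e.R cov p) := by
  have := e.isRicciFamily hcov (e.smooth_curv hcov) 3
  norm_num at this
  exact this

lemma isRicciFamily_S {s : M → 𝕜} (hcov : W.IsChernConnection cov) (hs : SmoothFunNear s p) :
    WebPoly.IsRicciFamily (e.R cov p) 1 (e.S cov s p) := by
  have := e.isRicciFamily hcov hs 2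
  norm_num at this
  exact this

/-- `f` is smooth near `p` and its derivative along `e_i` at `p` is `a`. -/
structure HasL (i : ℕ) (f : M → 𝕜) (a : 𝕜) : Prop where
  smooth : SmoothFunNear f p
  L_eq : e.L i f p = a

namespace HasL

variable {e} {i : ℕ} {f g : M → 𝕜} {a b : 𝕜}

lemma of_eq (hf : e.HasL i f a) (h : a = b) : e.HasL i f b := h ▸ hf

lemma const (c : 𝕜) : e.HasL i (fun _ => c) 0 := ⟨.const c, lieD_const c⟩

lemma add (hf : e.HasL i f a) (hg : e.HasL i g b) : e.HasL i (fun x => f x + g x) (a + b) :=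
  ⟨hf.1.add hg.1, by rw [e.L_add hf.1 hg.1, hf.2, hg.2]⟩

lemma sub (hf : e.HasL i f a) (hg : e.HasL i g b) : e.HasL i (fun x => f x - g x) (a - b) :=
  ⟨hf.1.sub hg.1, by rw [e.L_sub hf.1 hg.1, hf.2, hg.2]⟩

lemma mul (hf : e.HasL i f a) (hg : e.HasL i g b) :
    e.HasL i (fun x => f x * g x) (a * g p + f p * b) :=
  ⟨hf.1.mul hg.1, by rw [e.L_mul hf.1 hg.1, hf.2, hg.2]⟩

lemma sq (hf : e.HasL i f a) : e.HasL i (fun x => f x ^ 2) (a * f p + f p * a) := by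
  simpa only [pow_two] using hf.mul hf

lemma cube (hf : e.HasL i f a) :
    e.HasL i (fun x => f x ^ 3) ((a * f p + f p * a) * f p + f p ^ 2 * a) := by
  simpa only [pow_succ _ 2] using hf.sq.mul hf

end HasL

lemma hasL_R (hcov : W.IsChernConnection cov) (i : ℕ) (l : List ℕ) :
    e.HasL i (fun x => e.R cov x l)
      (e.R cov p (i :: l) + (2 + l.length) * (e.conn cov i p * e.R cov p l)) :=
  ⟨e.smooth_derivs hcov (e.smooth_curv hcov) 3 l,
    ((e.L_derivs hcov (e.smooth_curv hcov) 3 i l).self_of_nhds).trans (by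
      simp only [R]; push_cast; ring)⟩

lemma hasL_S {s : M → 𝕜} (hcov : W.IsChernConnection cov) (hs : SmoothFunNear s p) (i : ℕ)
    (l : List ℕ) : e.HasL i (fun x => e.S cov s x l)
      (e.S cov s p (i :: l) + (1 + l.length) * (e.conn cov i p * e.S cov s p l)) :=
  ⟨e.smooth_derivs hcov hs 2 l,
    ((e.L_derivs hcov hs 2 i l).self_of_nhds).trans (by
      simp only [S]; push_cast; ring)⟩

section

variable {s : M → 𝕜}

/-- s_l has weight 1 + |l| and 𝓡_l has weight 2 + |l|. Every monomial of P₂ has total weight 3, so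
the connection terms add up to 3ω_i times the whole expression. -/
lemma hasL_P2a (hcov : W.IsChernConnection cov) (hs : SmoothFunNear s p) (i : ℕ) :
    e.HasL i (fun x => WebPoly.P2a (e.R cov x) (e.S cov s x))
    (WebPoly.P2aCov (e.R cov p) (e.S cov s p) i +
      3 * e.conn cov i p * WebPoly.P2a (e.R cov p) (e.S cov s p)) := by
  have hR := e.hasL_R hcov i
  have hS := e.hasL_S hcov hs i
  apply HasL.of_eq
  · unfold WebPoly.P2a
    repeat' first
      | exact hR _
      | exact hS _
      | exact HasL.const _
      | apply HasL.add
      | apply HasL.sub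
      | apply HasL.mul
  · simp only [WebPoly.P2a, WebPoly.P2aCov, List.length_cons, List.length_nil]
    push_cast
    ring

lemma hasL_P2b (hcov : W.IsChernConnection cov) (hs : SmoothFunNear s p) (i : ℕ) :
    e.HasL i (fun x => WebPoly.P2b (e.R cov x) (e.S cov s x))
    (WebPoly.P2bCov (e.R cov p) (e.S cov s p) i +
      3 * e.conn cov i p * WebPoly.P2b (e.R cov p) (e.S cov s p)) := by
  have hR := e.hasL_R hcov i
  have hS := e.hasL_S hcov hs i
  apply HasL.of_eq
  · unfold WebPoly.P2b
    repeat' first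
      | exact hR _
      | exact hS _
      | exact HasL.const _
      | apply HasL.add
      | apply HasL.sub
      | apply HasL.mul
  · simp only [WebPoly.P2b, WebPoly.P2bCov, List.length_cons, List.length_nil]
    push_cast
    ring

/-- Every monomial of φ has weight 5. -/
lemma hasL_phi (hcov : W.IsChernConnection cov) (hs : SmoothFunNear s p) (i : ℕ) :
    e.HasL i (fun x => WebPoly.phi (e.R cov x) (e.S cov s x))
    (WebPoly.phiCov (e.R cov p) (e.S cov s p) i +
      5 * e.conn cov i p * WebPoly.phi (e.R cov p) (e.S cov s p)) := by
  have hR := e.hasL_R hcov i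
  have hS := e.hasL_S hcov hs i
  apply HasL.of_eq
  · unfold WebPoly.phi
    repeat' first
      | exact hR _
      | exact hS _
      | exact HasL.const _
      | apply HasL.add
      | apply HasL.sub
      | apply HasL.mul
      | apply HasL.sq
      | apply HasL.cube
  · simp only [WebPoly.phi, WebPoly.phiCov, List.length_cons, List.length_nil]
    push_cast
    ring

end

end ThreeWeb.AdaptedFrame

end FrameAlgebra

/-! ### Jets in the chart at p and derivatives along vector fields. -/

section Jets

variable {𝕜 : Type*} [RCLike 𝕜] {M : Type*} [TopologicalSpace M] [ChartedSpace (Plane 𝕜) M]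
  {p : M} {f g : M → 𝕜}

lemma SameJet.trans {k : ℕ} {h : M → 𝕜} (h₁ : SameJet k f g p) (h₂ : SameJet k g h p) :
    SameJet k f h p := fun i hi => (h₁ i hi).trans (h₂ i hi)

lemma mvfderiv_eq_fderiv_chart (hf : SmoothFunNear f p) (v : Plane 𝕜) :
    mvfderiv 𝓘(𝕜, Plane 𝕜) f p v =
      fderiv 𝕜 (f ∘ (extChartAt 𝓘(𝕜, Plane 𝕜) p).symm) (extChartAt 𝓘(𝕜, Plane 𝕜) p p) v := by
  have h := hf.mdifferentiableAt
  simp only [mvfderiv, mfderiv, h, writtenInExtChartAt, extChartAt_model_space_eq_id,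
    modelWithCornersSelf_coe, Set.range_id, fderivWithin_univ]
  rfl

lemma sameJet_zero_iff : SameJet 0 f 0 p ↔ f p = 0 := by
  constructor
  · intro h
    have := congr($(h 0 le_rfl) 0)
    simpa using this
  · intro h i hi
    obtain rfl : i = 0 := by omega
    ext
    simp [h]

lemma sameJet_one_iff (hf : SmoothFunNear f p) :
    SameJet 1 f 0 p ↔ f p = 0 ∧ ∀ v : Plane 𝕜, mvfderiv 𝓘(𝕜, Plane 𝕜) f p v = 0 := by
  simp only [mvfderiv_eq_fderiv_chart hf]
  constructor
  · intro h
    refine ⟨sameJet_zero_iff.1 fun i hi => h i (by omega), fun v => ?_⟩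
    have := congr($(h 1 le_rfl) (fun _ => v))
    rw [iteratedFDeriv_one_apply, iteratedFDeriv_one_apply] at this
    rw [this]
    have h0 : ((0 : M → 𝕜) ∘ (extChartAt 𝓘(𝕜, Plane 𝕜) p).symm) = fun _ => 0 := rfl
    rw [h0, fderiv_fun_const]
    rfl
  · rintro ⟨h0, h1⟩ i hi
    interval_cases i
    · exact sameJet_zero_iff.2 h0 0 le_rfl
    · ext m
      rw [iteratedFDeriv_one_apply, iteratedFDeriv_one_apply]
      refine (h1 (m 0)).trans ?_
      have h0 : ((0 : M → 𝕜) ∘ (extChartAt 𝓘(𝕜, Plane 𝕜) p).symm) = fun _ => 0 := rfl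
      rw [h0, fderiv_fun_const]
      rfl

lemma SameJet.eq (h : SameJet 2 f g p) : f p = g p := by
  have := congr($(h 0 (by omega)) 0)
  simpa using this

lemma SameJet.fderiv_eq (h : SameJet 2 f g p) :
    fderiv 𝕜 (f ∘ (extChartAt 𝓘(𝕜, Plane 𝕜) p).symm) (extChartAt 𝓘(𝕜, Plane 𝕜) p p) =
      fderiv 𝕜 (g ∘ (extChartAt 𝓘(𝕜, Plane 𝕜) p).symm) (extChartAt 𝓘(𝕜, Plane 𝕜) p p) := by
  ext v
  have := congr($(h 1 (by omega)) (fun _ => v))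
  rwa [iteratedFDeriv_one_apply, iteratedFDeriv_one_apply] at this

lemma SameJet.lieD_eq {X : (x : M) → TangentSpace 𝓘(𝕜, Plane 𝕜) x} (h : SameJet 2 f g p) (hf : SmoothFunNear f p) (hg : SmoothFunNear g p) :
    lieD X f p = lieD X g p := by
  refine (mvfderiv_eq_fderiv_chart hf (X p)).trans
    (Eq.trans ?_ (mvfderiv_eq_fderiv_chart hg (X p)).symm)
  rw [h.fderiv_eq]

lemma eventually_mem_chart_source (𝕜 : Type*) [RCLike 𝕜] {M : Type*} [TopologicalSpace M]
    [ChartedSpace (Plane 𝕜) M] (p : M) :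
    ∀ᶠ y in 𝓝 p, y ∈ (extChartAt 𝓘(𝕜, Plane 𝕜) p).source :=
  extChartAt_source_mem_nhds p

variable [IsManifold 𝓘(𝕜, Plane 𝕜) ∞ M]

lemma SmoothFunNear.contDiffAt_chart (hf : SmoothFunNear f p) :
    ∀ᶠ y in 𝓝 p, ContDiffAt 𝕜 ∞ (f ∘ (extChartAt 𝓘(𝕜, Plane 𝕜) p).symm)
      (extChartAt 𝓘(𝕜, Plane 𝕜) p y) := by
  filter_upwards [hf, eventually_mem_chart_source 𝕜 p] with y h₁ h₂
  rw [← contMDiffAt_iff_contDiffAt]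
  have hs : ContMDiffAt 𝓘(𝕜, Plane 𝕜) 𝓘(𝕜, Plane 𝕜) ∞ (extChartAt 𝓘(𝕜, Plane 𝕜) p).symm
      (extChartAt 𝓘(𝕜, Plane 𝕜) p y) :=
    (contMDiffOn_extChartAt_symm p).contMDiffAt
      ((isOpen_extChartAt_target p).mem_nhds ((extChartAt 𝓘(𝕜, Plane 𝕜) p).map_source h₂))
  refine ContMDiffAt.comp _ ?_ hs
  rwa [(extChartAt 𝓘(𝕜, Plane 𝕜) p).left_inv h₂]

/-- The vector field `X` in the chart at `p`. -/
def chartVec (p : M) (X : (x : M) → TangentSpace 𝓘(𝕜, Plane 𝕜) x) (y : M) : Plane 𝕜 :=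
  mfderiv 𝓘(𝕜, Plane 𝕜) 𝓘(𝕜, Plane 𝕜) (extChartAt 𝓘(𝕜, Plane 𝕜) p) y (X y)

lemma lieD_comp_chart {X : (x : M) → TangentSpace 𝓘(𝕜, Plane 𝕜) x} {y : M} {G : Plane 𝕜 → 𝕜}
    (hy : y ∈ (extChartAt 𝓘(𝕜, Plane 𝕜) p).source)
    (hG : DifferentiableAt 𝕜 G (extChartAt 𝓘(𝕜, Plane 𝕜) p y)) :
    lieD X (G ∘ extChartAt 𝓘(𝕜, Plane 𝕜) p) y = fderiv 𝕜 G (extChartAt 𝓘(𝕜, Plane 𝕜) p y)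
      (chartVec p X y) := by
  have hφ : MDifferentiableAt 𝓘(𝕜, Plane 𝕜) 𝓘(𝕜, Plane 𝕜) (extChartAt 𝓘(𝕜, Plane 𝕜) p) y :=
    (contMDiffAt_extChartAt' (n := ∞) (by simpa using hy)).mdifferentiableAt (by simp)
  have h := mvfderiv_comp_apply (x := y) hG.mdifferentiableAt hφ (X y)
  refine h.trans ?_
  simp only [mvfderiv, mfderiv_eq_fderiv]
  rfl

lemma smooth_comp_chart {G : Plane 𝕜 → 𝕜}
    (hG : ∀ᶠ y in 𝓝 p, ContDiffAt 𝕜 ∞ G (extChartAt 𝓘(𝕜, Plane 𝕜) p y)) :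
    SmoothFunNear (G ∘ extChartAt 𝓘(𝕜, Plane 𝕜) p) p := by
  filter_upwards [hG, eventually_mem_chart_source 𝕜 p] with y h₁ h₂
  exact ContMDiffAt.comp y h₁.contMDiffAt (contMDiffAt_extChartAt' (by simpa using h₂))

/-- The partial derivative of `f` in the chart at `p`. -/
def chartPartial (p : M) (f : M → 𝕜) (k : Fin 2) : M → 𝕜 :=
  (fun u => fderiv 𝕜 (f ∘ (extChartAt 𝓘(𝕜, Plane 𝕜) p).symm) u (EuclideanSpace.single k 1)) ∘
    extChartAt 𝓘(𝕜, Plane 𝕜) p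

/-- The coordinate functions of the chart at `p`. -/
def chartCoord (𝕜 : Type*) [RCLike 𝕜] {M : Type*} [TopologicalSpace M]
    [ChartedSpace (Plane 𝕜) M] (p : M) (k : Fin 2) : M → 𝕜 :=
  (fun u : Plane 𝕜 => u k) ∘ extChartAt 𝓘(𝕜, Plane 𝕜) p

lemma smooth_chartCoord (k : Fin 2) : SmoothFunNear (chartCoord 𝕜 p k) p :=
  smooth_comp_chart (Eventually.of_forall fun _ =>
    (EuclideanSpace.proj (𝕜 := 𝕜) k).contDiff.contDiffAt)

lemma contDiffAt_chartPartial (hf : SmoothFunNear f p) (k : Fin 2) :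
    ∀ᶠ y in 𝓝 p, ContDiffAt 𝕜 ∞ (fun u => fderiv 𝕜 (f ∘ (extChartAt 𝓘(𝕜, Plane 𝕜) p).symm) u
      (EuclideanSpace.single k 1)) (extChartAt 𝓘(𝕜, Plane 𝕜) p y) := by
  filter_upwards [hf.contDiffAt_chart] with y hy
  exact (hy.fderiv_right (m := ∞) (by simp)).clm_apply contDiffAt_const

lemma smooth_chartPartial (hf : SmoothFunNear f p) (k : Fin 2) :
    SmoothFunNear (chartPartial p f k) p :=
  smooth_comp_chart (contDiffAt_chartPartial hf k)

variable {X Y : (x : M) → TangentSpace 𝓘(𝕜, Plane 𝕜) x}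

/-- The coefficients X(x_k) do not depend on f, which reduces iterated derivatives along fields to
partial derivatives in one chart. -/
lemma lieD_eq_sum_chartPartial (hf : SmoothFunNear f p) : lieD X f =ᶠ[𝓝 p] fun y =>
    lieD X (chartCoord 𝕜 p 0) y * chartPartial p f 0 y +
      lieD X (chartCoord 𝕜 p 1) y * chartPartial p f 1 y := by
  filter_upwards [eventually_eventually_nhds.2 (eventually_mem_chart_source 𝕜 p),
    hf.contDiffAt_chart] with y h₁ h₂
  have hcomp : f =ᶠ[𝓝 y]
      (f ∘ (extChartAt 𝓘(𝕜, Plane 𝕜) p).symm) ∘ extChartAt 𝓘(𝕜, Plane 𝕜) p := by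
    filter_upwards [h₁] with z hz
    exact congrArg f ((extChartAt 𝓘(𝕜, Plane 𝕜) p).left_inv hz).symm
  have hk : ∀ k : Fin 2, lieD X (chartCoord 𝕜 p k) y =
      chartVec p X y k := fun k => by
    have hp : DifferentiableAt 𝕜 (fun u : Plane 𝕜 => u k) (extChartAt 𝓘(𝕜, Plane 𝕜) p y) :=
      (EuclideanSpace.proj (𝕜 := 𝕜) k).differentiableAt
    rw [chartCoord, lieD_comp_chart h₁.self_of_nhds hp]
    exact congr($((EuclideanSpace.proj (𝕜 := 𝕜) (ι := Fin 2) k).fderiv) _)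
  rw [lieD_congr hcomp, lieD_comp_chart h₁.self_of_nhds (h₂.differentiableAt (by simp)), hk, hk]
  generalize chartVec p X y = w
  have hw : w = w 0 • EuclideanSpace.single 0 1 + w 1 • EuclideanSpace.single 1 1 := by
    ext i; fin_cases i <;> simp
  conv_lhs => rw [hw]
  rw [map_add, map_smul, map_smul]
  rfl

lemma SameJet.lieD_chartPartial_eq (h : SameJet 2 f g p) (hf : SmoothFunNear f p)
    (hg : SmoothFunNear g p) (k : Fin 2) :
    lieD X (chartPartial p f k) p = lieD X (chartPartial p g k) p := by
  have key : ∀ q : M → 𝕜, SmoothFunNear q p → ∀ w : Plane 𝕜,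
      fderiv 𝕜 (fun u => fderiv 𝕜 (q ∘ (extChartAt 𝓘(𝕜, Plane 𝕜) p).symm) u
        (EuclideanSpace.single k 1)) (extChartAt 𝓘(𝕜, Plane 𝕜) p p) w =
      iteratedFDeriv 𝕜 2 (q ∘ (extChartAt 𝓘(𝕜, Plane 𝕜) p).symm)
        (extChartAt 𝓘(𝕜, Plane 𝕜) p p) ![w, EuclideanSpace.single k 1] := fun q hq w => by
    have hd := (hq.contDiffAt_chart.self_of_nhds.fderiv_right (m := ∞) (by simp)).differentiableAt
      (by simp)
    rw [iteratedFDeriv_two_apply, fderiv_clm_apply hd (differentiableAt_const _)]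
    simp
  rw [chartPartial, chartPartial,
    lieD_comp_chart (mem_extChartAt_source p)
      ((contDiffAt_chartPartial hf k).self_of_nhds.differentiableAt (by simp)),
    lieD_comp_chart (mem_extChartAt_source p)
      ((contDiffAt_chartPartial hg k).self_of_nhds.differentiableAt (by simp)),
    key f hf, key g hg, h 2 le_rfl]

/-- In Xf = Σ X(x_k) ∂_k f, a further derivative at p meets only first and second partial
derivatives of f at p. -/
lemma SameJet.lieD_lieD_eq (h : SameJet 2 f g p) (hf : SmoothFunNear f p)
    (hg : SmoothFunNear g p) (hX : ∀ k : Fin 2, SmoothFunNear (lieD X (chartCoord 𝕜 p k)) p) :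
    lieD Y (lieD X f) p = lieD Y (lieD X g) p := by
  have key : ∀ q : M → 𝕜, SmoothFunNear q p → lieD Y (lieD X q) p =
      lieD Y (lieD X (chartCoord 𝕜 p 0)) p * chartPartial p q 0 p +
        lieD X (chartCoord 𝕜 p 0) p * lieD Y (chartPartial p q 0) p +
      (lieD Y (lieD X (chartCoord 𝕜 p 1)) p * chartPartial p q 1 p +
        lieD X (chartCoord 𝕜 p 1) p * lieD Y (chartPartial p q 1) p) := fun q hq => by
    rw [lieD_congr (lieD_eq_sum_chartPartial hq), lieD_add ((hX 0).mul (smooth_chartPartial hq 0))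
      ((hX 1).mul (smooth_chartPartial hq 1)), lieD_mul (hX 0) (smooth_chartPartial hq 0),
      lieD_mul (hX 1) (smooth_chartPartial hq 1)]
  have hp : ∀ k, chartPartial p f k p = chartPartial p g k p := fun k => by
    simp only [chartPartial, Function.comp_apply, h.fderiv_eq]
  rw [key f hf, key g hg, h.lieD_chartPartial_eq hf hg, h.lieD_chartPartial_eq hf hg, hp, hp]

end Jets

/-! ### Cubic perturbations that leave the 2-jet unchanged. -/

section Cubic

variable {𝕜 : Type*} [RCLike 𝕜]

/-- Orders of vanishing add: in each term of the Leibniz bound for order i < m + n, either k < m or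
i − k < n. -/
lemma iteratedFDeriv_mul_eq_zero {E : Type*} [NormedAddCommGroup E] [NormedSpace 𝕜 E]
    {f g : E → 𝕜} {x : E} {m n : ℕ} (hf : ContDiff 𝕜 ∞ f) (hg : ContDiff 𝕜 ∞ g)
    (hfm : ∀ i < m, iteratedFDeriv 𝕜 i f x = 0) (hgn : ∀ i < n, iteratedFDeriv 𝕜 i g x = 0) :
    ∀ i < m + n, iteratedFDeriv 𝕜 i (fun y => f y * g y) x = 0 := by
  intro i hi
  rw [← norm_le_zero_iff]
  refine (norm_iteratedFDeriv_mul_le hf hg x (natCast_le_infty i)).trans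
    (Finset.sum_nonpos fun k hk => ?_)
  have := Finset.mem_range.1 hk
  rcases lt_or_ge k m with h | h
  · rw [hfm k h]; simp
  · rw [hgn (i - k) (by omega)]; simp

section

variable {M : Type*} [TopologicalSpace M] [ChartedSpace (Plane 𝕜) M]

/-- The linear functional `z` in the chart at `p`, vanishing at `p`. -/
def chartLinear (p : M) (z : Plane 𝕜 →L[𝕜] 𝕜) : M → 𝕜 :=
  fun y => z (extChartAt 𝓘(𝕜, Plane 𝕜) p y - extChartAt 𝓘(𝕜, Plane 𝕜) p p)

lemma chartLinear_self (p : M) (z : Plane 𝕜 →L[𝕜] 𝕜) : chartLinear p z p = 0 := by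
  simp [chartLinear]

lemma sameJet_add_mul_chartLinear {p : M} {s : M → 𝕜} (z₁ z₂ z₃ : Plane 𝕜 →L[𝕜] 𝕜)
    (hs : ContDiffAt 𝕜 ∞ (s ∘ (extChartAt 𝓘(𝕜, Plane 𝕜) p).symm)
      (extChartAt 𝓘(𝕜, Plane 𝕜) p p)) :
    SameJet 2 (fun y => s y +
      chartLinear p z₁ y * (chartLinear p z₂ y * chartLinear p z₃ y)) s p := by
  intro i hi
  set u₀ := extChartAt 𝓘(𝕜, Plane 𝕜) p p
  have hz : ∀ z : Plane 𝕜 →L[𝕜] 𝕜, ContDiff 𝕜 ∞ (fun u => z (u - u₀)) := fun z =>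
    z.contDiff.comp (contDiff_id.sub contDiff_const)
  have h1 : ∀ z : Plane 𝕜 →L[𝕜] 𝕜, ∀ i < 1, iteratedFDeriv 𝕜 i (fun u => z (u - u₀)) u₀ = 0 := by
    intro z i hi
    obtain rfl : i = 0 := by omega
    ext
    simp
  have h := iteratedFDeriv_mul_eq_zero (hz z₁) ((hz z₂).mul (hz z₃)) (h1 z₁)
    (iteratedFDeriv_mul_eq_zero (hz z₂) (hz z₃) (h1 z₂) (h1 z₃)) i (by omega)
  have hev : (fun y => s y + chartLinear p z₁ y * (chartLinear p z₂ y * chartLinear p z₃ y)) ∘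
      (extChartAt 𝓘(𝕜, Plane 𝕜) p).symm =ᶠ[𝓝 u₀]
      (s ∘ (extChartAt 𝓘(𝕜, Plane 𝕜) p).symm) +
        (fun u => z₁ (u - u₀) * (z₂ (u - u₀) * z₃ (u - u₀))) := by
    filter_upwards [extChartAt_target_mem_nhds (I := 𝓘(𝕜, Plane 𝕜)) p] with u hu
    simp only [Function.comp_apply, chartLinear, Pi.add_apply,
      (extChartAt 𝓘(𝕜, Plane 𝕜) p).right_inv hu]
    rfl
  rw [(hev.iteratedFDeriv 𝕜 i).eq_of_nhds, iteratedFDeriv_add_apply (hs.of_le (natCast_le_infty i))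
    (((hz z₁).mul ((hz z₂).mul (hz z₃))).contDiffAt.of_le (natCast_le_infty i)), h, add_zero]

variable [IsManifold 𝓘(𝕜, Plane 𝕜) ∞ M] {p : M}

lemma smooth_chartLinear (z : Plane 𝕜 →L[𝕜] 𝕜) : SmoothFunNear (chartLinear p z) p :=
  smooth_comp_chart (G := fun u => z (u - extChartAt 𝓘(𝕜, Plane 𝕜) p p))
    (Eventually.of_forall fun _ =>
      (z.contDiff.comp (contDiff_id.sub contDiff_const)).contDiffAt)

lemma lieD_chartLinear (z : Plane 𝕜 →L[𝕜] 𝕜) (X : (x : M) → TangentSpace 𝓘(𝕜, Plane 𝕜) x) :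
    lieD X (chartLinear p z) p = z (X p) := by
  refine (mvfderiv_eq_fderiv_chart (smooth_chartLinear z) (X p)).trans ?_
  have hev : chartLinear p z ∘ (extChartAt 𝓘(𝕜, Plane 𝕜) p).symm =ᶠ[𝓝
      (extChartAt 𝓘(𝕜, Plane 𝕜) p p)] fun u => z (u - extChartAt 𝓘(𝕜, Plane 𝕜) p p) := by
    filter_upwards [extChartAt_target_mem_nhds (I := 𝓘(𝕜, Plane 𝕜)) p] with u hu
    simp only [Function.comp_apply, chartLinear, (extChartAt 𝓘(𝕜, Plane 𝕜) p).right_inv hu]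
  rw [hev.fderiv_eq]
  have : HasFDerivAt (fun u : Plane 𝕜 => z (u - extChartAt 𝓘(𝕜, Plane 𝕜) p p)) z
      (extChartAt 𝓘(𝕜, Plane 𝕜) p p) := by
    have := z.hasFDerivAt.comp (extChartAt 𝓘(𝕜, Plane 𝕜) p p)
      ((hasFDerivAt_id (𝕜 := 𝕜) _).sub_const (extChartAt 𝓘(𝕜, Plane 𝕜) p p))
    rwa [ContinuousLinearMap.comp_id] at this
  rw [this.fderiv]

namespace ThreeWeb.AdaptedFrame

variable {W : ThreeWeb 𝕜 M} (e : W.AdaptedFrame p) {cov : LinearConnection 𝕜 M}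
  {c d : M → 𝕜}

lemma derivs_add (hcov : W.IsChernConnection cov) (hc : SmoothFunNear c p)
    (hd : SmoothFunNear d p) (m : ℕ) (l : List ℕ) :
    e.derivs cov m (fun x => c x + d x) l =ᶠ[𝓝 p] fun y =>
      e.derivs cov m c l y + e.derivs cov m d l y := by
  induction l with
  | nil => exact EventuallyEq.refl _ _
  | cons i l ih =>
    filter_upwards [e.derivs_cons hcov (hc.add hd) m i l, e.derivs_cons hcov hc m i l,
      e.derivs_cons hcov hd m i l, ih.eventuallyEq_nhds,
      (e.smooth_derivs hcov hc m l).eventually, (e.smooth_derivs hcov hd m l).eventually]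
      with y h₁ h₂ h₃ h₄ h₅ h₆
    rw [h₁, h₂, h₃, h₄.self_of_nhds]
    rw [L, lieD_congr h₄, lieD_add h₅ h₆]
    ring

variable {m n r : ℕ}

/-- The condition m + n = r + 1 is additivity of weights, (m−1) + (n−1) = r−1; it lets the
connection terms cancel. -/
lemma derivs_mul_one (hcov : W.IsChernConnection cov) (hc : SmoothFunNear c p)
    (hd : SmoothFunNear d p) (hr : m + n = r + 1) (i : ℕ) :
    e.derivs cov r (fun x => c x * d x) [i] =ᶠ[𝓝 p] fun y =>
      e.derivs cov m c [i] y * e.derivs cov n d [] y +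
        e.derivs cov m c [] y * e.derivs cov n d [i] y := by
  have hr' : (m + n : 𝕜) = r + 1 := by exact_mod_cast hr
  filter_upwards [e.derivs_cons hcov (hc.mul hd) r i [],
    e.L_derivs_mul_derivs hcov hc hd m n i [] []] with y h₁ h₂
  rw [h₁]
  refine (congrArg (· - _) h₂).trans ?_
  simp only [derivs, List.length_nil]
  push_cast
  linear_combination (e.conn cov i y * (c y * d y)) * hr'

lemma derivs_mul_two (hcov : W.IsChernConnection cov) (hc : SmoothFunNear c p)
    (hd : SmoothFunNear d p) (hr : m + n = r + 1) (j i : ℕ) :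
    e.derivs cov r (fun x => c x * d x) [j, i] =ᶠ[𝓝 p] fun y =>
      e.derivs cov m c [j, i] y * e.derivs cov n d [] y +
        e.derivs cov m c [i] y * e.derivs cov n d [j] y +
      (e.derivs cov m c [j] y * e.derivs cov n d [i] y +
        e.derivs cov m c [] y * e.derivs cov n d [j, i] y) := by
  have hr' : (m + n : 𝕜) = r + 1 := by exact_mod_cast hr
  have sc := fun l => e.smooth_derivs hcov hc m l
  have sd := fun l => e.smooth_derivs hcov hd n l
  filter_upwards [e.derivs_cons hcov (hc.mul hd) r j [i],
    (e.derivs_mul_one hcov hc hd hr i).eventuallyEq_nhds,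
    e.L_derivs_mul_derivs hcov hc hd m n j [i] [], e.L_derivs_mul_derivs hcov hc hd m n j [] [i],
    ((sc [i]).mul (sd [])).eventually, ((sc []).mul (sd [i])).eventually] with y h₁ h₂ h₃ h₄ h₅ h₆
  rw [L] at h₁ h₃ h₄
  rw [h₁, h₂.self_of_nhds, lieD_congr h₂, lieD_add h₅ h₆, h₃, h₄]
  simp only [List.length_cons, List.length_nil]
  push_cast
  linear_combination (e.conn cov j y * (e.derivs cov m c [i] y * e.derivs cov n d [] y +
    e.derivs cov m c [] y * e.derivs cov n d [i] y)) * hr'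

lemma derivs_mul_three (hcov : W.IsChernConnection cov) (hc : SmoothFunNear c p)
    (hd : SmoothFunNear d p) (hr : m + n = r + 1) (k j i : ℕ) :
    e.derivs cov r (fun x => c x * d x) [k, j, i] p =
      e.derivs cov m c [k, j, i] p * d p +
        e.derivs cov m c [j, i] p * e.derivs cov n d [k] p +
      (e.derivs cov m c [k, i] p * e.derivs cov n d [j] p +
        e.derivs cov m c [i] p * e.derivs cov n d [k, j] p) +
      (e.derivs cov m c [k, j] p * e.derivs cov n d [i] p +
        e.derivs cov m c [j] p * e.derivs cov n d [k, i] p +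
      (e.derivs cov m c [k] p * e.derivs cov n d [j, i] p +
        c p * e.derivs cov n d [k, j, i] p)) := by
  have hr' : (m + n : 𝕜) = r + 1 := by exact_mod_cast hr
  have sc := fun l => e.smooth_derivs hcov hc m l
  have sd := fun l => e.smooth_derivs hcov hd n l
  have h₁ := (e.derivs_cons hcov (hc.mul hd) r k [j, i]).self_of_nhds
  have h₂ := e.derivs_mul_two hcov hc hd hr j i
  have h := fun l l' => (e.L_derivs_mul_derivs hcov hc hd m n k l l').self_of_nhds
  simp only [L] at h₁ h
  have s₁ := (sc [j, i]).mul (sd [])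
  have s₂ := (sc [i]).mul (sd [j])
  have s₃ := (sc [j]).mul (sd [i])
  have s₄ := (sc []).mul (sd [j, i])
  rw [h₁, h₂.self_of_nhds, lieD_congr h₂, lieD_add (s₁.add s₂) (s₃.add s₄), lieD_add s₁ s₂,
    lieD_add s₃ s₄, h, h, h, h]
  simp only [List.length_cons, List.length_nil]
  push_cast
  have hc0 : e.derivs cov m c [] p = c p := rfl
  have hd0 : e.derivs cov n d [] p = d p := rfl
  rw [hc0, hd0]
  linear_combination (e.conn cov k p * (e.derivs cov m c [j, i] p * d p +
        e.derivs cov m c [i] p * e.derivs cov n d [j] p +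
      (e.derivs cov m c [j] p * e.derivs cov n d [i] p +
        c p * e.derivs cov n d [j, i] p))) * hr'

/-- The value of `e_i` at `p`, as a vector of the model space. -/
def vecAt (i : ℕ) : Plane 𝕜 := e.vec i p

/-- The function vanishes at p, which kills the connection term whatever m is. -/
lemma derivs_chartLinear (hcov : W.IsChernConnection cov) (m i : ℕ) (z : Plane 𝕜 →L[𝕜] 𝕜) :
    e.derivs cov m (chartLinear p z) [i] p = z (e.vecAt i) := by
  have := (e.derivs_cons hcov (smooth_chartLinear z) m i []).self_of_nhds
  rw [this]
  simp only [derivs, chartLinear_self, L]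
  rw [lieD_chartLinear, mul_zero, mul_zero, sub_zero]
  rfl

/-- At p only the terms in which each linear factor is differentiated exactly once survive, which
leaves the polarised cubic. The factors get degrees m = 2, 1, 1 so that the product has the degree 2
of s. -/
lemma S_add_mul_chartLinear (hcov : W.IsChernConnection cov) {s : M → 𝕜}
    (hs : SmoothFunNear s p) (z₁ z₂ z₃ : Plane 𝕜 →L[𝕜] 𝕜) (k j i : ℕ) :
    e.S cov (fun y => s y + chartLinear p z₁ y * (chartLinear p z₂ y * chartLinear p z₃ y)) p
      [k, j, i] = e.S cov s p [k, j, i] +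
      (z₁ (e.vecAt k) * (z₂ (e.vecAt j) * z₃ (e.vecAt i) + z₂ (e.vecAt i) * z₃ (e.vecAt j)) +
      z₁ (e.vecAt j) * (z₂ (e.vecAt k) * z₃ (e.vecAt i) + z₂ (e.vecAt i) * z₃ (e.vecAt k)) +
      z₁ (e.vecAt i) * (z₂ (e.vecAt k) * z₃ (e.vecAt j) + z₂ (e.vecAt j) * z₃ (e.vecAt k))) := by
  have h := fun z : Plane 𝕜 →L[𝕜] 𝕜 => smooth_chartLinear (p := p) z
  have h0 : ∀ m z, e.derivs cov m (chartLinear p z) [] p = 0 := fun m z => chartLinear_self p z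
  have hq1 : ∀ i, e.derivs cov 1 (fun y => chartLinear p z₂ y * chartLinear p z₃ y) [i] p = 0 :=
    fun i => by
      rw [(e.derivs_mul_one (m := 1) (n := 1) hcov (h z₂) (h z₃) rfl i).self_of_nhds]
      beta_reduce
      rw [h0, h0]
      ring
  have hq2 : ∀ j i, e.derivs cov 1 (fun y => chartLinear p z₂ y * chartLinear p z₃ y) [j, i] p =
      z₂ (e.vecAt i) * z₃ (e.vecAt j) + z₂ (e.vecAt j) * z₃ (e.vecAt i) := fun j i => by
    rw [(e.derivs_mul_two (m := 1) (n := 1) hcov (h z₂) (h z₃) rfl j i).self_of_nhds]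
    beta_reduce
    rw [h0, h0]
    simp only [e.derivs_chartLinear hcov]
    ring
  rw [S, (e.derivs_add hcov hs ((h z₁).mul ((h z₂).mul (h z₃))) 2 _).self_of_nhds]
  beta_reduce
  rw [e.derivs_mul_three (m := 2) (n := 1) hcov (h z₁) ((h z₂).mul (h z₃)) rfl]
  simp only [hq1, hq2, e.derivs_chartLinear hcov, chartLinear_self, S]
  ring

end ThreeWeb.AdaptedFrame

end

end Cubic

/-! ### Formal solutions of order 3 and the choice of third derivatives. -/

section Lifting

variable {𝕜 : Type*} [RCLike 𝕜] {M : Type*} [TopologicalSpace M] [ChartedSpace (Plane 𝕜) M]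
  [IsManifold 𝓘(𝕜, Plane 𝕜) ∞ M]

namespace ThreeWeb.AdaptedFrame

variable {W : ThreeWeb 𝕜 M} {p : M} (e : W.AdaptedFrame p) {cov : LinearConnection 𝕜 M}
  {s s' f : M → 𝕜}

lemma exists_dual : ∃ z₁ z₂ : Plane 𝕜 →L[𝕜] 𝕜, z₁ (e.vecAt 1) = 1 ∧ z₁ (e.vecAt 2) = 0 ∧
    z₂ (e.vecAt 1) = 0 ∧ z₂ (e.vecAt 2) = 1 := by
  have h : LinearIndependent 𝕜 ![e.vecAt 1, e.vecAt 2] := e.linearIndependent.self_of_nhds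
  let b := basisOfLinearIndependentOfCardEqFinrank h (by simp)
  have hb : ∀ i j, b.coord i (![e.vecAt 1, e.vecAt 2] j) = if j = i then 1 else 0 := fun i j => by
    have : ![e.vecAt 1, e.vecAt 2] j = b j := by simp [b]
    rw [this, Module.Basis.coord_apply, Module.Basis.repr_self, Finsupp.single_apply]
  exact ⟨(b.coord 0).toContinuousLinearMap, (b.coord 1).toContinuousLinearMap,
    by simpa using hb 0 0, by simpa using hb 0 1, by simpa using hb 1 0, by simpa using hb 1 1⟩

lemma sameJet_one_iff_L (hf : SmoothFunNear f p) :
    SameJet 1 f 0 p ↔ f p = 0 ∧ e.L 1 f p = 0 ∧ e.L 2 f p = 0 := by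
  rw [sameJet_one_iff hf]
  refine and_congr_right fun _ => ⟨fun h => ⟨h _, h _⟩, fun h v => ?_⟩
  obtain ⟨a, b, hab⟩ := e.exists_coeff.self_of_nhds v
  have h₁ : mvfderiv 𝓘(𝕜, Plane 𝕜) f p (e.e₁ p) = 0 := h.1
  have h₂ : mvfderiv 𝓘(𝕜, Plane 𝕜) f p (e.e₂ p) = 0 := h.2
  change mvfderiv 𝓘(𝕜, Plane 𝕜) f p (show TangentSpace 𝓘(𝕜, Plane 𝕜) p from v) = 0
  rw [hab, map_add, map_smul, map_smul, h₁, h₂]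
  simp

lemma isFormalSolution_two_iff : e.IsFormalSolution cov 2 s ↔
    WebPoly.P2a (e.R cov p) (e.S cov s p) = 0 ∧ WebPoly.P2b (e.R cov p) (e.S cov s p) = 0 ∧
      WebPoly.phi (e.R cov p) (e.S cov s p) = 0 := by
  rw [IsFormalSolution]
  exact and_congr sameJet_zero_iff (and_congr sameJet_zero_iff sameJet_zero_iff)

/-- The ordinary and covariant derivatives of the three equations differ by multiples of their
values, which vanish at p. -/
lemma isFormalSolution_three_iff (hcov : W.IsChernConnection cov) (hs : SmoothFunNear s p) :
    e.IsFormalSolution cov 3 s ↔ e.IsFormalSolution cov 2 s ∧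
      (WebPoly.P2aCov (e.R cov p) (e.S cov s p) 1 = 0 ∧
        WebPoly.P2aCov (e.R cov p) (e.S cov s p) 2 = 0) ∧
      (WebPoly.P2bCov (e.R cov p) (e.S cov s p) 1 = 0 ∧
        WebPoly.P2bCov (e.R cov p) (e.S cov s p) 2 = 0) ∧
      WebPoly.phiCov (e.R cov p) (e.S cov s p) 1 = 0 ∧
        WebPoly.phiCov (e.R cov p) (e.S cov s p) 2 = 0 := by
  have ha := e.hasL_P2a hcov hs
  have hb := e.hasL_P2b hcov hs
  have hφ := e.hasL_phi hcov hs
  rw [isFormalSolution_two_iff, IsFormalSolution, e.sameJet_one_iff_L (ha 1).1,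
    e.sameJet_one_iff_L (hb 1).1, e.sameJet_one_iff_L (hφ 1).1, (ha 1).2, (ha 2).2, (hb 1).2,
    (hb 2).2, (hφ 1).2, (hφ 2).2]
  constructor
  · rintro ⟨⟨h1, h2, h3⟩, ⟨h4, h5, h6⟩, h7, h8, h9⟩
    simp only [h1, h4, h7, mul_zero, add_zero] at h2 h3 h5 h6 h8 h9
    exact ⟨⟨h1, h4, h7⟩, ⟨h2, h3⟩, ⟨h5, h6⟩, h8, h9⟩
  · rintro ⟨⟨h1, h4, h7⟩, ⟨h2, h3⟩, ⟨h5, h6⟩, h8, h9⟩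
    simp [*]

lemma S_eq_of_sameJet (hcov : W.IsChernConnection cov) (hs : SmoothFunNear s p)
    (hs' : SmoothFunNear s' p) (h : SameJet 2 s' s p) :
    e.S cov s' p [] = e.S cov s p [] ∧ (∀ i, e.S cov s' p [i] = e.S cov s p [i]) ∧
      ∀ j i, e.S cov s' p [j, i] = e.S cov s p [j, i] := by
  have hL : ∀ i, e.L i s' p = e.L i s p := fun i => h.lieD_eq hs' hs
  have hLL : ∀ j i, e.L j (e.L i s') p = e.L j (e.L i s) p := fun j i =>
    h.lieD_lieD_eq hs' hs fun k => e.smooth_L i (smooth_chartCoord k)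
  refine ⟨h.eq, fun i => ?_, fun j i => ?_⟩
  · rw [S, S, (e.derivs_cons hcov hs 2 i []).self_of_nhds,
      (e.derivs_cons hcov hs' 2 i []).self_of_nhds]
    simp only [derivs, hL, h.eq]
  · rw [S, S, (e.derivs_cons_cons hcov hs 2 j i []).self_of_nhds,
      (e.derivs_cons_cons hcov hs' 2 j i []).self_of_nhds]
    simp only [derivs, hL, hLL, h.eq]

/-- The third derivatives of a section can be changed at will, up to symmetry, without changing
its `2`-jet. -/
lemma exists_third_order (hcov : W.IsChernConnection cov) (hs : SmoothFunNear s p)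
    (a b c d : 𝕜) : ∃ s' : M → 𝕜, SmoothFunNear s' p ∧ SameJet 2 s' s p ∧
      e.S cov s' p [1,1,1] = e.S cov s p [1,1,1] + a ∧
      e.S cov s' p [1,2,1] = e.S cov s p [1,2,1] + b ∧
      e.S cov s' p [2,1,1] = e.S cov s p [2,1,1] + b ∧
      e.S cov s' p [1,2,2] = e.S cov s p [1,2,2] + c ∧
      e.S cov s' p [2,2,1] = e.S cov s p [2,2,1] + c ∧
      e.S cov s' p [2,2,2] = e.S cov s p [2,2,2] + d := by
  obtain ⟨z₁, z₂, h11, h12, h21, h22⟩ := e.exists_dual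
  have step : ∀ (z₁ z₂ z₃ : Plane 𝕜 →L[𝕜] 𝕜) (s : M → 𝕜), SmoothFunNear s p →
      ∃ s' : M → 𝕜, SmoothFunNear s' p ∧ SameJet 2 s' s p ∧ ∀ k j i,
        e.S cov s' p [k, j, i] = e.S cov s p [k, j, i] +
          (z₁ (e.vecAt k) * (z₂ (e.vecAt j) * z₃ (e.vecAt i) + z₂ (e.vecAt i) * z₃ (e.vecAt j)) +
            z₁ (e.vecAt j) * (z₂ (e.vecAt k) * z₃ (e.vecAt i) + z₂ (e.vecAt i) * z₃ (e.vecAt k)) +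
            z₁ (e.vecAt i) * (z₂ (e.vecAt k) * z₃ (e.vecAt j) + z₂ (e.vecAt j) * z₃ (e.vecAt k))) :=
      fun z₁ z₂ z₃ s hs =>
    ⟨_, hs.add ((smooth_chartLinear z₁).mul ((smooth_chartLinear z₂).mul (smooth_chartLinear z₃))),
      sameJet_add_mul_chartLinear z₁ z₂ z₃ hs.contDiffAt_chart.self_of_nhds,
      e.S_add_mul_chartLinear hcov hs z₁ z₂ z₃⟩
  -- Polarising z₁³ gives 6 on (1,1,1), and z₁²z₂ gives 2 on each arrangement of 1, 1, 2; hence the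
  -- divisors 6 and 2. Distinct monomials do not interfere.
  obtain ⟨s₁, m₁, j₁, v₁⟩ := step ((a / 6) • z₁) z₁ z₁ s hs
  obtain ⟨s₂, m₂, j₂, v₂⟩ := step ((b / 2) • z₁) z₁ z₂ s₁ m₁
  obtain ⟨s₃, m₃, j₃, v₃⟩ := step ((c / 2) • z₁) z₂ z₂ s₂ m₂
  obtain ⟨s₄, m₄, j₄, v₄⟩ := step ((d / 6) • z₂) z₂ z₂ s₃ m₃
  refine ⟨s₄, m₄, j₄.trans (j₃.trans (j₂.trans j₁)), ?_⟩
  simp only [v₄, v₃, v₂, v₁, smul_apply, h11, h12, h21, h22, smul_eq_mul]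
  refine ⟨?_, ?_, ?_, ?_, ?_, ?_⟩ <;> ring

end ThreeWeb.AdaptedFrame

end Lifting

end

/-! ### The lifting criterion. -/

theorem mainTheorem5 {𝕜 : Type*} [RCLike 𝕜] {M : Type*} [TopologicalSpace M]
    [ChartedSpace (Plane 𝕜) M] [IsManifold 𝓘(𝕜, Plane 𝕜) ∞ M]
    (W : ThreeWeb 𝕜 M) (cov : LinearConnection 𝕜 M) (hcov : W.IsChernConnection cov)
    (p : M) (e : W.AdaptedFrame p) (hR : e.curv cov p ≠ 0)
    (s : M → 𝕜) (hs : SmoothFunNear s p) (hsol : e.IsFormalSolution cov 2 s) :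
    (∃ s' : M → 𝕜, SmoothFunNear s' p ∧ SameJet 2 s' s p ∧ e.IsFormalSolution cov 3 s') ↔
      WebPoly.psi1 (e.R cov p) (e.S cov s p) = 0 ∧
      WebPoly.psi2 (e.R cov p) (e.S cov s p) = 0 := by
  have hRp : e.R cov p [] ≠ 0 := hR
  have hRic := e.isRicciFamily_R hcov
  have psi_eq : ∀ s' : M → 𝕜, SmoothFunNear s' p → SameJet 2 s' s p →
      WebPoly.psi1 (e.R cov p) (e.S cov s' p) = WebPoly.psi1 (e.R cov p) (e.S cov s p) ∧
      WebPoly.psi2 (e.R cov p) (e.S cov s' p) = WebPoly.psi2 (e.R cov p) (e.S cov s p) := by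
    intro s' hs' hj
    obtain ⟨h0, h1, -⟩ := e.S_eq_of_sameJet hcov hs hs' hj
    simp only [WebPoly.psi1, WebPoly.psi2, h0, h1, and_self]
  constructor
  · rintro ⟨s', hs', hj, h3⟩
    obtain ⟨h2, ⟨ha, -⟩, ⟨-, hb⟩, hφ₁, hφ₂⟩ := (e.isFormalSolution_three_iff hcov hs').1 h3
    obtain ⟨va, vb, vφ⟩ := e.isFormalSolution_two_iff.1 h2
    have h := WebPoly.psi_eq_prolongation hRp va vb vφ hφ₁ hφ₂ hRic (e.isRicciFamily_S hcov hs')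
    rw [ha, hb, mul_zero, (psi_eq s' hs' hj).1, (psi_eq s' hs' hj).2] at h
    exact ⟨h.1.symm, h.2.symm⟩
  · rintro ⟨hψ₁, hψ₂⟩
    -- Adding b to s_121 changes φ_1 by −24𝓡 b, and adding c to s_221 changes φ_2 by −24𝓡 c; b and c
    -- are chosen to make both vanish.
    obtain ⟨b, hb⟩ : ∃ b, b = WebPoly.phiCov (e.R cov p) (e.S cov s p) 1 / (24 * e.R cov p []) :=
      ⟨_, rfl⟩
    obtain ⟨c, hc⟩ : ∃ c, c = WebPoly.phiCov (e.R cov p) (e.S cov s p) 2 / (24 * e.R cov p []) :=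
      ⟨_, rfl⟩
    rw [eq_div_iff (by simpa using hRp)] at hb hc
    -- The leading parts s_111 − 2 s_121 and s_222 − 2 s_221 dictate the other two increments: 2b
    -- and 2c compensate the changes already made.
    obtain ⟨s', hs', hj, v111, v121, -, -, v221, v222⟩ := e.exists_third_order hcov hs
      (2 * b - WebPoly.P2bCov (e.R cov p) (e.S cov s p) 1) b c
      (2 * c - WebPoly.P2aCov (e.R cov p) (e.S cov s p) 2)
    obtain ⟨h0, h1, h2⟩ := e.S_eq_of_sameJet hcov hs hs' hj
    obtain ⟨va, vb, vφ⟩ := e.isFormalSolution_two_iff.1 hsol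
    have va' : WebPoly.P2a (e.R cov p) (e.S cov s' p) = 0 := by
      simpa only [WebPoly.P2a, h0, h1, h2] using va
    have vb' : WebPoly.P2b (e.R cov p) (e.S cov s' p) = 0 := by
      simpa only [WebPoly.P2b, h0, h1, h2] using vb
    have vφ' : WebPoly.phi (e.R cov p) (e.S cov s' p) = 0 := by
      simpa only [WebPoly.phi, h0, h1, h2] using vφ
    have hφ₁ : WebPoly.phiCov (e.R cov p) (e.S cov s' p) 1 = 0 := by
      rw [WebPoly.phiCov] at hb ⊢
      simp only [h0, h1, h2, v121]
      linear_combination -hb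
    have hφ₂ : WebPoly.phiCov (e.R cov p) (e.S cov s' p) 2 = 0 := by
      rw [WebPoly.phiCov] at hc ⊢
      simp only [h0, h1, h2, v221]
      linear_combination -hc
    have hb₁ : WebPoly.P2bCov (e.R cov p) (e.S cov s' p) 1 = 0 := by
      rw [WebPoly.P2bCov] at v111 ⊢
      rw [h0, h1, h1, h2, h2, v111, v121]
      ring
    have ha₂ : WebPoly.P2aCov (e.R cov p) (e.S cov s' p) 2 = 0 := by
      rw [WebPoly.P2aCov] at v222 ⊢
      rw [h0, h1, h1, h2, h2, v221, v222]
      ring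
    -- No freedom is left; the last two equations hold because 24𝓡 times their left sides are ψ¹ and
    -- ψ².
    have h := WebPoly.psi_eq_prolongation hRp va' vb' vφ' hφ₁ hφ₂ hRic (e.isRicciFamily_S hcov hs')
    rw [(psi_eq s' hs' hj).1, (psi_eq s' hs' hj).2, hψ₁, hψ₂] at h
    have h24 : 24 * e.R cov p [] ≠ 0 := by simpa using hRp
    exact ⟨s', hs', hj, (e.isFormalSolution_three_iff hcov hs').2
      ⟨e.isFormalSolution_two_iff.2 ⟨va', vb', vφ'⟩,
        ⟨(mul_eq_zero.1 h.1).resolve_left h24, ha₂⟩,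
        ⟨hb₁, (mul_eq_zero.1 h.2).resolve_left h24⟩, hφ₁, hφ₂⟩⟩
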